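/- Definitions. Write $V=\mathbb Z/2\times\mathbb Z/2$; all homology and cohomology below is with trivial coefficients. Let $f:G\to H$ be a surjection of finite groups whose kernel $P$ has abelianization $P_{ab}$ of odd order. The central extensions of $P$ by $H_2(P,\mathbb Z/2)$ are classified by $H^2(P,H_2(P,\mathbb Z/2))\cong \mathrm{Hom}(H_2(P,\mathbb Z),H_2(P,\mathbb Z/2))$; let $1\to H_2(P,\mathbb Z/2)\to C\to P\to 1$ be the one that corresponds to the map induced by the reduction $\mathbb Z\to\mathbb Z/2$. There is a unique action of $G$ on $C$, compatible with the conjugation actions of $G$ on $P$ and on $H_2(P,\mathbb Z/2)$, for which $C\to P\hookrightarrow G$ is a crossed module. The $\mathbb Z/2$-obstruction of $f$ is the class in $H^3(H,H_2(P,\mathbb Z/2))$ of the crossed module $C\to G$. A finite group $G$ has property $(\ast)_b$ if there is a surjection $f:G\to V$, with kernel $P$, such that $|P_{ab}|$ is odd, $H_2(P,\mathbb Z/2)\cong\mathbb Z/2$, and the $\mathbb Z/2$-obstruction of $f$ in $H^3(V,H_2(P,\mathbb Z/2))\cong H^3(V,\mathbb Z/2)$ equals $a^2\cup b$ for some distinct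 non-zero $a,b\in H^1(V,\mathbb Z/2)$. We then say that $f$ exhibits property $(\ast)_b$ of $G$. Proposition. Let $p$ be an odd prime, $m\ge 1$, $q=p^m$, and let $\alpha:x\mapsto x^q$ be the generator of $\mathrm{Gal}(\mathbb F_{q^2}/\mathbb F_q)$. (1) The group $\mathrm{PSL}(2,q^2)$ is perfect and $H_2(\mathrm{PSL}(2,q^2),\mathbb Z/2)\cong\mathbb Z/2$. (2) The group $\mathrm{PGL}(2,q^2)\rtimes\langle\alpha\rangle$ has property $(\ast)_b$. More precisely, there is an exact sequence $1\to \mathrm{PSL}(2,q^2)\to \mathrm{PGL}(2,q^2)\rtimes\langle\alpha\rangle\xrightarrow{f} V\to 1$, whose first map is the natural inclusion, such that $f$ exhibits property $(\ast)_b$. (3) If $q=p$ is prime, then there is an exact sequence $1\to \mathrm{PSL}(2,q^2)\to\mathrm{Aut}(\mathrm{PSL}(2,q^2))\xrightarrow{f} V\to 1$, whose first map is the inclusion as inner automorphisms, such that $f$ exhibits property $(\ast)_b$. (4) If $m$ is odd, then $\mathrm{Aut}(\mathrm{PSL}(2,q^2))$ has property $(\ast)_b$. -/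

import Mathlib

open CategoryTheory Matrix
open scoped MatrixGroups

noncomputable section

namespace EmbeddingObstruction

/-! ### Homology and cohomology with trivial coefficients -/

/-- The second homology group `H₂(P, A)` with coefficients in the trivial module `A`. -/
abbrev Homology2 (P : Type) [Group P] (A : Type) [AddCommGroup A] : ModuleCat ℤ :=
  groupHomology (Rep.trivial ℤ P A) 2

/-- The map `H₂(P, ℤ) → H₂(P, A)` induced by the coefficient map `ℤ → A` with `1 ↦ a`. -/
def coeffMap (P : Type) [Group P] {A : Type} [AddCommGroup A] (a : A) :
    Homology2 P ℤ ⟶ Homology2 P A :=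
  (groupHomology.functor ℤ P 2).map
    ((Rep.trivialFunctor ℤ P).map (ModuleCat.ofHom (LinearMap.toSpanSingleton ℤ A a)))

/-- The map on `H₂(P, A)` induced by an automorphism of `P`. -/
def homology2Map {P : Type} [Group P] (A : Type) [AddCommGroup A] (θ : MulAut P) :
    Homology2 P A ⟶ Homology2 P A :=
  groupHomology.map (A := Rep.trivial ℤ P A) (B := Rep.trivial ℤ P A) θ.toMonoidHom
    (Rep.ofHom ⟨LinearMap.id, fun _ => rfl⟩) 2

/-- The cohomology group `Hⁿ(H, ℤ/2)` (trivial action). -/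
abbrev CohomologyMod2 (H : Type) [Group H] (n : ℕ) : ModuleCat ℤ :=
  groupCohomology (Rep.trivial ℤ H (ZMod 2)) n

/-- The homomorphism `H → ℤ/2` that corresponds to a class in `H¹(H, ℤ/2)`. -/
def homOfClass {H : Type} [Group H] (a : CohomologyMod2 H 1) : Additive H →+ ZMod 2 :=
  (groupCohomology.H1IsoOfIsTrivial (Rep.trivial ℤ H (ZMod 2))).hom a

/-- The cup product of three homomorphisms `H → ℤ/2`, on the level of inhomogeneous cochains:
`(g, h, k) ↦ a(g) b(h) c(k)`. -/
def tripleCupCochain {H : Type} [Group H] (a b c : Additive H →+ ZMod 2) :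
    (Fin 3 → H) → ZMod 2 :=
  fun g => a (Additive.ofMul (g 0)) * b (Additive.ofMul (g 1)) * c (Additive.ofMul (g 2))

theorem tripleCupCochain_d {H : Type} [Group H] (a b c : Additive H →+ ZMod 2) :
    inhomogeneousCochains.d (Rep.trivial ℤ H (ZMod 2)) 3 (tripleCupCochain a b c) = 0 := by
  funext g
  change (inhomogeneousCochains.d (Rep.trivial ℤ H (ZMod 2)) 3).hom (tripleCupCochain a b c) g = 0
  rw [inhomogeneousCochains.d_hom_apply]
  have hs : ∀ v : Fin (3 + 1) → ZMod 2, ∑ j, v j = v 0 + v 1 + v 2 + v 3 := Fin.sum_univ_four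
  refine (congrArg₂ (· + ·) rfl (hs _)).trans ?_
  simp [tripleCupCochain, Fin.contractNth, Representation.trivial, ofMul_mul, map_add]
  have h2 : (2 : ZMod 2) = 0 := rfl
  ring_nf
  simp [h2]

/-- The cup product `a ∪ b ∪ c ∈ H³(H, ℤ/2)` of three classes of degree one. -/
def tripleCup {H : Type} [Group H] (a b c : CohomologyMod2 H 1) : CohomologyMod2 H 3 :=
  groupCohomology.π _ 3
    (groupCohomology.cocyclesMk (A := Rep.trivial ℤ H (ZMod 2))
      (tripleCupCochain (homOfClass a) (homOfClass b) (homOfClass c)) (tripleCupCochain_d _ _ _))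

/-! ### Crossed modules and the obstruction class -/

/-- A crossed module `d : C → G`; `act g c` is the action, written `ᵍc`. -/
structure CrossedModule (C G : Type) [Group C] [Group G] where
  d : C →* G
  act : G →* MulAut C
  d_act : ∀ g c, d (act g c) = g * d c * g⁻¹
  act_d : ∀ c c', act (d c) c' = c * c' * c⁻¹

/-- Let `f : G → H` have kernel `P`. The crossed module `X` on `d : C → G`, together with
`ι : H₂(P, A) → C`, is the `(A, a)`-obstruction crossed module of `f`: the sequence
`1 → H₂(P, A) → C → G → H` is exact, the action of `G` on `C` restricts to the action on
`H₂(P, A)` induced by conjugation, and the class in `H²(P, H₂(P, A))` of the central extension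
`1 → H₂(P, A) → C → P → 1` is mapped by the universal coefficient homomorphism
`H²(P, H₂(P, A)) → Hom(H₂(P, ℤ), H₂(P, A))` to the map induced by `ℤ → A`, `1 ↦ a`.
(The extension is central by `act_d`; the action on `P` is conjugation by `d_act`.) -/
structure IsObstructionCrossedModule {G H : Type} [Group G] [Group H] (f : G →* H)
    {A : Type} [AddCommGroup A] (a : A) {C : Type} [Group C] (X : CrossedModule C G)
    (ι : Multiplicative (Homology2 f.ker A) →* C) : Prop where
  injective_ι : Function.Injective ι
  range_ι : ι.range = X.d.ker
  range_d : X.d.range = f.ker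
  act_ι : ∀ (g : G) (n : Homology2 f.ker A),
    X.act g (ι (Multiplicative.ofAdd n)) =
      ι (Multiplicative.ofAdd (homology2Map A (MulAut.conjNormal (H := f.ker) g) n))
  /-- `u` is the 2-cocycle of the extension for the set-theoretic section `σ`. -/
  class_eq : ∃ (σ : f.ker → C) (u : f.ker → f.ker → Homology2 f.ker A),
    (∀ x, X.d (σ x) = x) ∧
    (∀ x y, σ x * σ y = ι (Multiplicative.ofAdd (u x y)) * σ (x * y)) ∧
    ∀ z : groupHomology.cycles₂ (Rep.trivial ℤ f.ker ℤ),
      (Finsupp.sum z.1 fun xy (n : ℤ) => n • u xy.1 xy.2) =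
        coeffMap f.ker a (groupHomology.H2π (Rep.trivial ℤ f.ker ℤ) z)

/-- The class `x ∈ H³(H, ℤ/2)` is the `ℤ/2`-obstruction of `f : G → H`, where `H₂(ker f, ℤ/2)` is
identified with `ℤ/2` by `e`: it is represented by the 3-cocycle `c` that measures the failure of
associativity of lifts `F` to `C` of the factor set of a set-theoretic section `s` of `f`, for an
obstruction crossed module `C → G` of `f`. -/
def IsObstructionClass {G H : Type} [Group G] [Group H] (f : G →* H)
    (e : Homology2 f.ker (ZMod 2) ≃+ ZMod 2) (x : CohomologyMod2 H 3) : Prop :=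
  ∃ (C : Type) (_ : Group C) (X : CrossedModule C G)
    (ι : Multiplicative (Homology2 f.ker (ZMod 2)) →* C),
    IsObstructionCrossedModule f (1 : ZMod 2) X ι ∧
    ∃ (s : H → G) (F : H → H → C)
      (c : groupCohomology.cocycles (Rep.trivial ℤ H (ZMod 2)) 3),
      (∀ h, f (s h) = h) ∧
      (∀ g h, s g * s h = X.d (F g h) * s (g * h)) ∧
      (∀ g h k, X.act (s g) (F h k) * F g (h * k) =
        ι (Multiplicative.ofAdd
          (e.symm (groupCohomology.iCocycles (Rep.trivial ℤ H (ZMod 2)) 3 c ![g, h, k]))) *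
          (F g h * F (g * h) k)) ∧
      x = groupCohomology.π (Rep.trivial ℤ H (ZMod 2)) 3 c

/-! ### The property `(∗)_b` -/

/-- The group `ℤ/2 × ℤ/2`. -/
abbrev V4 : Type := Multiplicative (ZMod 2 × ZMod 2)

/-- The homomorphism `f : G → ℤ/2 × ℤ/2` exhibits the property `(∗)_b` of the finite group `G`. -/
structure ExhibitsStarB {G : Type} [Group G] (f : G →* V4) : Prop where
  finite : Finite G
  surjective : Function.Surjective f
  odd_ab : Odd (Nat.card (Abelianization f.ker))
  /-- `H₂(ker f, ℤ/2) = ℤ/2`, and *the* obstruction class is `a² ∪ b` with `a ≠ b` non-zero. -/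
  obstruction : ∃ (e : Homology2 f.ker (ZMod 2) ≃+ ZMod 2) (a b : CohomologyMod2 V4 1),
    a ≠ 0 ∧ b ≠ 0 ∧ a ≠ b ∧ {x | IsObstructionClass f e x} = {tripleCup a a b}

/-- The property `(∗)_b` of a finite group. -/
def HasStarB (G : Type) [Group G] : Prop := ∃ f : G →* V4, ExhibitsStarB f

/-! ### The groups -/

/-- The action of field automorphisms on `GL(2, F)`, entry by entry. -/
def glAut (F : Type) [Field F] : (F ≃+* F) →* MulAut (GL (Fin 2) F) where
  toFun σ := Units.mapEquiv (RingEquiv.mapMatrix σ).toMulEquiv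
  map_one' := by ext; rfl
  map_mul' σ τ := by ext; rfl

/-- The action of field automorphisms on `PGL(2, F)`. -/
def pglAut (F : Type) [Field F] : (F ≃+* F) →* MulAut PGL(2, F) where
  toFun σ := QuotientGroup.congr _ _ (glAut F σ)
    (Subgroup.characteristic_iff_map_eq.mp inferInstance (glAut F σ))
  map_one' := by
    ext x
    induction x using Matrix.ProjGenLinGroup.induction_on with
    | mk g => rfl
  map_mul' σ τ := by
    ext x
    induction x using Matrix.ProjGenLinGroup.induction_on with
    | mk g => rfl

/-- The semidirect product `PGL(2, F) ⋊ ⟨α⟩` for an automorphism `α` of the field `F`. -/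
abbrev PGLSemidirect (F : Type) [Field F] (α : F ≃+* F) : Type :=
  PGL(2, F) ⋊[(pglAut F).comp (Subgroup.zpowers α).subtype] (Subgroup.zpowers α)

/-- The natural homomorphism `PSL(2, F) → PGL(2, F) → PGL(2, F) ⋊ ⟨α⟩`. -/
def pslIncl (F : Type) [Field F] (α : F ≃+* F) : PSL(2, F) →* PGLSemidirect F α :=
  SemidirectProduct.inl.comp Matrix.ProjectiveSpecialLinearGroup.toPGL

end EmbeddingObstruction

end

open EmbeddingObstruction

/-!
Write `q = 2 r + 1` and `|F| = q²`. The kernel `P` of each homomorphism `f : G → V` considered here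
is the image of a group `E = SL(2, F) ⋊ Γ`, with `Γ` cyclic of odd order, under a homomorphism
`d : E → G` with kernel `{1, z}`, where `z` is the matrix `-1`. Two properties of `E` carry the
whole argument: `E_ab` has odd order, and every central extension of `E` by `ℤ/2` splits
(`SplitsModTwo`). The second one follows by transfer to a subgroup of odd index, the one generated
by the diagonal torus and the Weyl element of `SL(2, F)`. It is a generalised quaternion group
`⟨x, y⟩`, and in a central extension of it by `ℤ/2` the kernel meets the commutator subgroup
trivially (`splitsModTwo_of_quaternion`).

Consequently homomorphisms lift uniquely along double covers of their targets
(`IsDoubleCover.exists_lift`, `IsDoubleCover.lift_unique`). This makes `E → P` the extension whose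
class generates `H²(P, ℤ/2)`, so that evaluation of its cocycle identifies `H₂(P, ℤ/2)` with `ℤ/2`
(`nonempty_homology2_addEquiv`). The conjugation action of `G` lifts to `E`, which gives an
obstruction crossed module `E → G`; it maps to every other one, so the obstruction class may be
computed from `E` alone (`IsDoubleCover.isObstructionClass_iff`).

For `G = PGL(2, F) ⋊ ⟨β⟩`, where an odd power `A` of `β` is `x ↦ x ^ q`, the coordinates of `f` are
the determinant modulo squares and the parity of the exponent of `β`. For a generator `ν` of `Fˣ`
let `D = diag(ν, 1)` and let `T = diag(ν, ν⁻¹)` in `E`. Then `D² = d T`, `A² = 1`,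
`A D = d(T ^ r) D A`, and the lifted actions of `D` and `A` map `T` to `T` and `T ^ q`. For the
section `(i, j) ↦ Dⁱ Aʲ` the factor set consists of powers of `T`, and associativity fails by the
cochain `(T ^ (2 r (r + 1))) ^ (j l m)` at `(i, j)`, `(k, l)`, `(m, n)`. As `T` has order
`q² - 1 = 4 r (r + 1)`, the element `T ^ (2 r (r + 1))` is `z`, and the obstruction is `a² ∪ b` for
the second and first coordinates `a` and `b` (`exists_exhibitsStarB`).

Finally, `PGL(2, F) ⋊ ⟨Frobenius⟩` acts on `PSL(2, F)` by conjugation, and this gives all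
automorphisms (`conjPSL_injective`, `conjPSL_surjective`): an automorphism of `PSL(2, F)` lifts to
`SL(2, F)`, and an automorphism of `SL(2, F)` is, after conjugation by a matrix, induced by a field
automorphism (`exists_eq_slConj_mul_slAut`).
-/

namespace EmbeddingObstruction

/-! ### Evaluation of two-cocycles on homology -/

theorem zmod_two_cases (a : ZMod 2) : a = 0 ∨ a = 1 := by
  revert a; decide

/-- An additive map to `ℤ/2` from a subgroup of a group of exponent two extends. -/
theorem exists_extend_zmod_two {M : Type*} [AddCommGroup M] (hM : ∀ m : M, 2 • m = 0)
    (S : AddSubgroup M) (f : S →+ ZMod 2) : ∃ g : M →+ ZMod 2, ∀ s : S, g s = f s := by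
  let : Module (ZMod 2) M := AddCommGroup.zmodModule hM
  let S' : Submodule (ZMod 2) M := AddSubgroup.toZModSubmodule 2 S
  let f' : S' →ₗ[ZMod 2] ZMod 2 := AddMonoidHom.toZModLinearMap 2 (f : S' →+ ZMod 2)
  obtain ⟨g, hg⟩ := LinearMap.exists_extend f'
  exact ⟨g.toAddMonoidHom, fun s => by
    have := congrArg (fun k => k s) hg
    exact this⟩

section Evaluation

variable {P : Type}

/-- Evaluation of a 2-cochain with values in `B` on integral 2-chains. -/
noncomputable def evalInt {B : Type} [AddCommGroup B] (u : P → P → B) : (P × P →₀ ℤ) →+ B :=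
  Finsupp.liftAddHom fun xy => (smulAddHom ℤ B).flip (u xy.1 xy.2)

theorem evalInt_apply {B : Type} [AddCommGroup B] (u : P → P → B) (z : P × P →₀ ℤ) :
    evalInt u z = z.sum fun xy n => n • u xy.1 xy.2 := by
  rfl

theorem evalInt_single {B : Type} [AddCommGroup B] (u : P → P → B) (x y : P) (n : ℤ) :
    evalInt u (Finsupp.single (x, y) n) = n • u x y := by
  simp [evalInt]

/-- Evaluation of a 2-cochain with values in `ℤ/2` on 2-chains modulo two. -/
noncomputable def evalTwo (u : P → P → ZMod 2) : (P × P →₀ ZMod 2) →+ ZMod 2 :=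
  Finsupp.liftAddHom fun xy => AddMonoidHom.mulRight (u xy.1 xy.2)

theorem evalTwo_single (u : P → P → ZMod 2) (x y : P) (n : ZMod 2) :
    evalTwo u (Finsupp.single (x, y) n) = n * u x y := by
  simp [evalTwo]

theorem two_nsmul_finsupp_zmod_two {α : Type*} (c : α →₀ ZMod 2) : 2 • c = 0 := by
  ext a
  have : (2 : ZMod 2) = 0 := rfl
  simp [this]

variable [Group P]

theorem d₂₁_trivial_single {A : Type} [AddCommGroup A] (x y : P) (a : A) :
    groupHomology.d₂₁ (Rep.trivial ℤ P A) (Finsupp.single (x, y) a) =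
      Finsupp.single y a - Finsupp.single (x * y) a + Finsupp.single x a :=
  groupHomology.d₂₁_single (A := Rep.trivial ℤ P A) (x, y) a

theorem odd_nsmul_of_two_nsmul {B : Type*} [AddCommGroup B] {b : B} (hb : 2 • b = 0) {n : ℕ}
    (hn : Odd n) : n • b = b := by
  obtain ⟨k, rfl⟩ := hn
  rw [add_smul, mul_comm, mul_smul, hb, smul_zero, zero_add, one_smul]

/-- If `P_ab` has odd order, a 2-cochain with values in a group of exponent two which vanishes on
all integral 2-cycles is a coboundary. -/
theorem exists_primitive_of_evalInt_eq_zero {B : Type} [AddCommGroup B] (hB : ∀ b : B, 2 • b = 0)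
    (hP : Odd (Nat.card (Abelianization P))) (u : P → P → B)
    (hu : ∀ z ∈ groupHomology.cycles₂ (Rep.trivial ℤ P ℤ), evalInt u z = 0) :
    ∃ φ : P → B, ∀ x y, u x y = φ x + φ y - φ (x * y) := by
  let D : (P × P →₀ ℤ) →ₗ[ℤ] (P →₀ ℤ) := (groupHomology.d₂₁ (Rep.trivial ℤ P ℤ)).hom
  have hD : ∀ x y, D (Finsupp.single (x, y) 1) =
      Finsupp.single y 1 - Finsupp.single (x * y) 1 + Finsupp.single x 1 :=
    fun x y => d₂₁_trivial_single x y 1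
  set n := Nat.card (Abelianization P)
  -- modulo boundaries, `x ↦ [x]` is a homomorphism to an abelian group, so `n [x]` is a boundary
  have key : ∀ x : P, ∃ w, D w = n • Finsupp.single x (1 : ℤ) := by
    intro x
    let q : P →* Multiplicative ((P →₀ ℤ) ⧸ LinearMap.range D) :=
      MonoidHom.mk' (fun x => Multiplicative.ofAdd (Submodule.Quotient.mk (Finsupp.single x 1)))
        (fun x y => by
          rw [← ofAdd_add, ← Submodule.Quotient.mk_add]
          apply congrArg
          rw [eq_comm, Submodule.Quotient.eq]
          exact ⟨Finsupp.single (x, y) 1, by rw [hD]; abel⟩)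
    have h1 : q x ^ n = 1 := by
      have : (Abelianization.of x) ^ n = 1 := pow_card_eq_one'
      rw [← Abelianization.lift_apply_of q, ← map_pow, this, map_one]
    have h2 : (Submodule.Quotient.mk (p := LinearMap.range D) (n • Finsupp.single x (1 : ℤ))) = 0 :=
      congrArg Multiplicative.toAdd h1
    rw [Submodule.Quotient.mk_eq_zero] at h2
    exact h2
  choose w hw using key
  refine ⟨fun x => evalInt u (w x), fun x y => ?_⟩
  have h := hu (w x + w y - w (x * y) - n • Finsupp.single (x, y) 1) (by
    change D _ = 0
    simp only [map_sub, map_add, map_nsmul, hD, hw]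
    rw [← smul_add, ← smul_sub, ← smul_sub]
    simp only [smul_eq_zero]
    right; abel)
  simp only [map_sub, map_add, map_nsmul, evalInt_single, one_smul] at h
  rw [odd_nsmul_of_two_nsmul (hB _) hP, sub_eq_zero] at h
  exact h.symm

/-- A 2-cochain with values in `ℤ/2` which vanishes on all 2-cycles modulo two is a coboundary. -/
theorem exists_primitive_of_evalTwo_eq_zero (u : P → P → ZMod 2)
    (hu : ∀ z ∈ groupHomology.cycles₂ (Rep.trivial ℤ P (ZMod 2)), evalTwo u z = 0) :
    ∃ φ : P → ZMod 2, ∀ x y, u x y = φ x + φ y - φ (x * y) := by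
  let D : (P × P →₀ ZMod 2) →+ (P →₀ ZMod 2) :=
    (groupHomology.d₂₁ (Rep.trivial ℤ P (ZMod 2))).hom.toAddMonoidHom
  have hD : ∀ x y, D (Finsupp.single (x, y) 1) =
      Finsupp.single y 1 - Finsupp.single (x * y) 1 + Finsupp.single x 1 :=
    fun x y => d₂₁_trivial_single x y 1
  have hker : ∀ c, D c = 0 → evalTwo u c = 0 := fun c hc => hu c hc
  let f : D.range →+ ZMod 2 :=
    (QuotientAddGroup.lift D.ker (evalTwo u) (fun c hc => hker c hc)).comp
      (QuotientAddGroup.quotientKerEquivRange D).symm.toAddMonoidHom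
  have hf : ∀ c, f ⟨D c, c, rfl⟩ = evalTwo u c := by
    intro c
    have : (QuotientAddGroup.quotientKerEquivRange D).symm ⟨D c, c, rfl⟩ =
        QuotientAddGroup.mk c := by
      rw [AddEquiv.symm_apply_eq]; rfl
    simp only [f, AddMonoidHom.comp_apply]
    exact (congrArg _ this).trans rfl
  obtain ⟨g, hg⟩ := exists_extend_zmod_two two_nsmul_finsupp_zmod_two D.range f
  refine ⟨fun x => g (Finsupp.single x 1), fun x y => ?_⟩
  have h := hg ⟨D (Finsupp.single (x, y) 1), _, rfl⟩
  rw [hf, evalTwo_single, one_mul] at h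
  rw [← h]
  simp only [hD, map_add, map_sub]
  abel

/-- The 2-cocycle condition for trivial coefficients. -/
def IsTwoCocycle {B : Type} [AddCommGroup B] (u : P → P → B) : Prop :=
  ∀ x y z, u y z + u x (y * z) = u (x * y) z + u x y

theorem evalTwo_boundary {u : P → P → ZMod 2} (hu : IsTwoCocycle u)
    (z : P × P →₀ ZMod 2) (hz : z ∈ groupHomology.boundaries₂ (Rep.trivial ℤ P (ZMod 2))) :
    evalTwo u z = 0 := by
  obtain ⟨c, rfl⟩ := hz
  induction c using Finsupp.induction_linear with
  | zero => simp
  | add f g hf hg =>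
    rw [map_add]
    exact (map_add (evalTwo u) _ _).trans (by rw [hf, hg, add_zero])
  | single g a =>
    obtain ⟨x, y, t⟩ := g
    have h := groupHomology.d₃₂_single (A := Rep.trivial ℤ P (ZMod 2)) (x, y, t) a
    refine (congrArg (evalTwo u) h).trans ?_
    refine Eq.trans (b := a * u y t - a * u (x * y) t + a * u x (y * t) - a * u x y) ?_ ?_
    · rw [← evalTwo_single, ← evalTwo_single, ← evalTwo_single, ← evalTwo_single,
        ← map_sub, ← map_add, ← map_sub]
      rfl
    · linear_combination a * hu x y t

/-- The evaluation of a 2-cocycle on `H₂(P, ℤ/2)`, defined on the quotient of the cycles by the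
kernel of their projection to homology. -/
noncomputable def evalH2 (u : P → P → ZMod 2) (hu : IsTwoCocycle u) :
    Homology2 P (ZMod 2) →+ ZMod 2 :=
  let q : groupHomology.cycles₂ (Rep.trivial ℤ P (ZMod 2)) →+ Homology2 P (ZMod 2) :=
    (groupHomology.H2π (Rep.trivial ℤ P (ZMod 2))).hom.toAddMonoidHom
  (QuotientAddGroup.lift q.ker
    ((evalTwo u).comp (groupHomology.cycles₂ (Rep.trivial ℤ P (ZMod 2))).subtype.toAddMonoidHom)
    (fun z hz => evalTwo_boundary hu _ ((groupHomology.H2π_eq_zero_iff z).1 hz))).comp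
  (QuotientAddGroup.quotientKerEquivOfSurjective q
    ((ModuleCat.epi_iff_surjective (groupHomology.H2π (Rep.trivial ℤ P (ZMod 2)))).1
      inferInstance)).symm.toAddMonoidHom

theorem evalH2_H2π (u : P → P → ZMod 2) (hu : IsTwoCocycle u)
    (z : groupHomology.cycles₂ (Rep.trivial ℤ P (ZMod 2))) :
    evalH2 u hu (groupHomology.H2π _ z) = evalTwo u z.1 := by
  let q : groupHomology.cycles₂ (Rep.trivial ℤ P (ZMod 2)) →+ Homology2 P (ZMod 2) :=
    (groupHomology.H2π (Rep.trivial ℤ P (ZMod 2))).hom.toAddMonoidHom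
  have hq : Function.Surjective q :=
    (ModuleCat.epi_iff_surjective (groupHomology.H2π (Rep.trivial ℤ P (ZMod 2)))).1 inferInstance
  have : (QuotientAddGroup.quotientKerEquivOfSurjective q hq).symm (q z) =
      QuotientAddGroup.mk z := by
    rw [AddEquiv.symm_apply_eq]; rfl
  exact (congrArg (QuotientAddGroup.lift q.ker
    ((evalTwo u).comp (groupHomology.cycles₂ (Rep.trivial ℤ P (ZMod 2))).subtype.toAddMonoidHom)
    (fun z hz => evalTwo_boundary hu _ ((groupHomology.H2π_eq_zero_iff z).1 hz))) this).trans rfl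

theorem two_nsmul_homology2 (n : Homology2 P (ZMod 2)) : 2 • n = 0 := by
  induction n using groupHomology.H2_induction_on with
  | h z =>
    rw [← map_nsmul]
    have : 2 • z = 0 := Subtype.ext (two_nsmul_finsupp_zmod_two _)
    rw [this, map_zero]

/-- If the class of `u` generates `H²(P, ℤ/2)`, evaluation of `u` is injective on `H₂(P, ℤ/2)`. -/
theorem evalH2_injective (u : P → P → ZMod 2) (hu : IsTwoCocycle u)
    (h : ∀ v : P → P → ZMod 2, IsTwoCocycle v → ∃ (ε : ZMod 2) (β : P → ZMod 2),
      ∀ x y, v x y = ε * u x y + (β x + β y - β (x * y))) :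
    Function.Injective (evalH2 u hu) := by
  rw [injective_iff_map_eq_zero]
  intro n hn
  by_contra hne
  let : Module (ZMod 2) (Homology2 P (ZMod 2)) := AddCommGroup.zmodModule two_nsmul_homology2
  obtain ⟨l, hl⟩ : ∃ l : Homology2 P (ZMod 2) →+ ZMod 2, l n ≠ 0 := by
    by_contra! hc
    exact hne ((Module.forall_dual_apply_eq_zero_iff (ZMod 2) n).1 fun φ => hc φ.toAddMonoidHom)
  -- a functional `l` that detects `n` is evaluation of a cocycle `v`, hence of a multiple of `u`
  let Z := groupHomology.cycles₂ (Rep.trivial ℤ P (ZMod 2))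
  obtain ⟨g, hg⟩ := exists_extend_zmod_two two_nsmul_finsupp_zmod_two Z.toAddSubgroup
    (l.comp (groupHomology.H2π (Rep.trivial ℤ P (ZMod 2))).hom.toAddMonoidHom)
  have hg' : ∀ z : Z, g z.1 = l (groupHomology.H2π _ z) := hg
  let v : P → P → ZMod 2 := fun x y => g (Finsupp.single (x, y) 1)
  have hv : evalTwo v = g := by
    ext ⟨x, y⟩ a
    refine (evalTwo_single v x y a).trans ?_
    obtain rfl | rfl := zmod_two_cases a
    · simp
    · simp [v]
  have hvc : IsTwoCocycle v := by
    intro x y t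
    have h3 := groupHomology.d₃₂_single (A := Rep.trivial ℤ P (ZMod 2)) (x, y, t) (1 : ZMod 2)
    let b : Z := ⟨groupHomology.d₃₂ (Rep.trivial ℤ P (ZMod 2)) (Finsupp.single (x, y, t) 1),
      groupHomology.d₃₂_apply_mem_cycles₂ _⟩
    have hb : groupHomology.H2π (Rep.trivial ℤ P (ZMod 2)) b = 0 :=
      (groupHomology.H2π_eq_zero_iff b).2 ⟨_, rfl⟩
    have h4 := hg' b
    rw [hb, map_zero] at h4
    have h5 : g (Finsupp.single (y, t) 1 - Finsupp.single (x * y, t) 1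
        + Finsupp.single (x, y * t) 1 - Finsupp.single (x, y) 1) = 0 :=
      (congrArg g h3).symm.trans h4
    simp only [map_sub, map_add] at h5
    change v y t - v (x * y) t + v x (y * t) - v x y = 0 at h5
    linear_combination h5
  obtain ⟨ε, β, hβ⟩ := h v hvc
  induction n using groupHomology.H2_induction_on with
  | h z =>
    rw [evalH2_H2π] at hn
    rw [← hg' z, ← hv] at hl
    apply hl
    -- the coboundary of `β` vanishes on cycles
    let s : (P →₀ ZMod 2) →+ ZMod 2 := Finsupp.liftAddHom fun x => AddMonoidHom.mulRight (β x)
    have hs : ∀ x a, s (Finsupp.single x a) = a * β x := fun x a => by simp [s]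
    have hdec : ∀ c : P × P →₀ ZMod 2, evalTwo v c = ε * evalTwo u c +
        s (groupHomology.d₂₁ (Rep.trivial ℤ P (ZMod 2)) c) := by
      intro c
      induction c using Finsupp.induction_linear with
      | zero => simp
      | add f g hf hg =>
        have : groupHomology.d₂₁ (Rep.trivial ℤ P (ZMod 2)) (f + g) =
          groupHomology.d₂₁ (Rep.trivial ℤ P (ZMod 2)) f +
          groupHomology.d₂₁ (Rep.trivial ℤ P (ZMod 2)) g := map_add _ _ _
        rw [this, map_add, map_add, hf, hg]
        refine Eq.trans ?_ (congrArg _ (map_add s _ _).symm)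
        ring
      | single g a =>
        obtain ⟨x, y⟩ := g
        rw [evalTwo_single, evalTwo_single, hβ]
        have := d₂₁_trivial_single x y a
        refine Eq.trans ?_ (congrArg (fun t => ε * (a * u x y) + s t) this.symm)
        simp only [map_add, map_sub, hs]
        ring
    rw [hdec, hn]
    have hz : groupHomology.d₂₁ (Rep.trivial ℤ P (ZMod 2)) z.1 = 0 := z.2
    rw [hz]
    simp

theorem evalH2_surjective (u : P → P → ZMod 2) (hu : IsTwoCocycle u)
    (h : ¬ ∃ φ : P → ZMod 2, ∀ x y, u x y = φ x + φ y - φ (x * y)) :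
    Function.Surjective (evalH2 u hu) := by
  have : ∃ n, evalH2 u hu n ≠ 0 := by
    by_contra! hc
    refine h (exists_primitive_of_evalTwo_eq_zero u fun z hz => ?_)
    rw [← evalH2_H2π u hu ⟨z, hz⟩, hc]
  obtain ⟨n, hn⟩ := this
  intro b
  obtain rfl | rfl := zmod_two_cases b
  · exact ⟨0, map_zero _⟩
  · refine ⟨n, ?_⟩
    generalize evalH2 u hu n = c at hn
    revert c; decide

theorem evalH2_coeffMap (u : P → P → ZMod 2) (hu : IsTwoCocycle u)
    (z : groupHomology.cycles₂ (Rep.trivial ℤ P ℤ)) :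
    evalH2 u hu (coeffMap P (1 : ZMod 2) (groupHomology.H2π _ z)) = evalInt u z.1 := by
  have h := groupHomology.H2π_comp_map_apply (MonoidHom.id P)
    (A := Rep.trivial ℤ P ℤ) (B := Rep.trivial ℤ P (ZMod 2))
    ((Rep.trivialFunctor ℤ P).map (ModuleCat.ofHom (LinearMap.toSpanSingleton ℤ (ZMod 2) 1))) z
  refine (congrArg _ h).trans ?_
  refine (evalH2_H2π u hu _).trans ?_
  rw [groupHomology.coe_mapCycles₂]
  have : ∀ c : P × P →₀ ℤ, evalTwo u (groupHomology.chainsMap₂ (MonoidHom.id P)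
    (A := Rep.trivial ℤ P ℤ) (B := Rep.trivial ℤ P (ZMod 2))
    ((Rep.trivialFunctor ℤ P).map
      (ModuleCat.ofHom (LinearMap.toSpanSingleton ℤ (ZMod 2) 1))) c) = evalInt u c := by
    intro c
    induction c using Finsupp.induction_linear with
    | zero => simp
    | add f g hf hg =>
      rw [map_add (evalInt u), map_add, ← hf, ← hg]
      exact map_add (evalTwo u) _ _
    | single g a =>
      obtain ⟨x, y⟩ := g
      rw [evalInt_single]
      have h1 : groupHomology.chainsMap₂ (MonoidHom.id P)
          (A := Rep.trivial ℤ P ℤ) (B := Rep.trivial ℤ P (ZMod 2))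
          ((Rep.trivialFunctor ℤ P).map
            (ModuleCat.ofHom (LinearMap.toSpanSingleton ℤ (ZMod 2) 1))) (Finsupp.single (x, y) a) =
          Finsupp.single (x, y) (a • (1 : ZMod 2)) := by
        refine (congrArg (Finsupp.mapRange _ (map_zero _)) Finsupp.mapDomain_single).trans ?_
        exact Finsupp.mapRange_single
      refine (congrArg (evalTwo u) h1).trans ?_
      rw [evalTwo_single, smul_mul_assoc, one_mul]
  exact this z.1

end Evaluation

/-! ### Double covers -/

/-- The kernel of the homomorphism `π` is the two-element group `{1, z}`. The element `z` is then
central; `π` is not required to be surjective. -/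
structure IsDoubleCover {D E : Type} [Group D] [Group E] (π : D →* E) (z : D) : Prop where
  ne_one : z ≠ 1
  ker_iff : ∀ d, π d = 1 ↔ d = 1 ∨ d = z

namespace IsDoubleCover

variable {D E : Type} [Group D] [Group E] {π : D →* E} {z : D} (h : IsDoubleCover π z)
include h

theorem map_z : π z = 1 := (h.ker_iff z).2 (Or.inr rfl)

theorem mul_self : z * z = 1 := by
  have : π (z * z) = 1 := by rw [map_mul, h.map_z, one_mul]
  rcases (h.ker_iff _).1 this with h1 | h1
  · exact h1
  · exact absurd (mul_eq_left.1 h1) h.ne_one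

theorem conj_z (d : D) : d * z * d⁻¹ = z := by
  have : π (d * z * d⁻¹) = 1 := by simp [h.map_z]
  rcases (h.ker_iff _).1 this with h1 | h1
  · exact absurd (conj_eq_one_iff.1 h1) h.ne_one
  · exact h1

theorem commute (d : D) : Commute z d := by
  have := h.conj_z d
  rw [mul_inv_eq_iff_eq_mul] at this
  exact this.symm

theorem pow_val_add (a b : ZMod 2) : z ^ (a + b).val = z ^ a.val * z ^ b.val := by
  have h2 : z * z = 1 := h.mul_self
  revert a b
  have : ∀ a b : ZMod 2, (a = 0 ∧ b = 0) ∨ (a = 0 ∧ b = 1) ∨ (a = 1 ∧ b = 0) ∨ (a = 1 ∧ b = 1) := by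
    decide
  intro a b
  have h3 : (1 + 1 : ZMod 2) = 0 := rfl
  rcases this a b with h | h | h | h <;> obtain ⟨rfl, rfl⟩ := h <;>
    simp [h3, h2, ZMod.val_one]

theorem pow_val_injective {a b : ZMod 2} (hab : z ^ a.val = z ^ b.val) : a = b := by
  have : ∀ a b : ZMod 2, a = b ∨ (a = 0 ∧ b = 1) ∨ (a = 1 ∧ b = 0) := by decide
  rcases this a b with h1 | h1 | h1
  · exact h1
  · obtain ⟨rfl, rfl⟩ := h1
    simp [ZMod.val_one] at hab
    exact absurd hab.symm h.ne_one
  · obtain ⟨rfl, rfl⟩ := h1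
    simp [ZMod.val_one] at hab
    exact absurd hab h.ne_one

theorem commute_pow (n : ℕ) (d : D) : Commute (z ^ n) d := (h.commute d).pow_left n

theorem map_pow (n : ℕ) : π (z ^ n) = 1 := by rw [_root_.map_pow, h.map_z, one_pow]

theorem exists_eq_pow_mul {x y : D} (hxy : π x = π y) : ∃ a : ZMod 2, x = z ^ a.val * y := by
  have : π (x * y⁻¹) = 1 := by simp [hxy]
  rcases (h.ker_iff _).1 this with h1 | h1
  · exact ⟨0, by simpa using mul_inv_eq_one.1 h1⟩
  · exact ⟨1, by simpa [ZMod.val_one] using mul_inv_eq_iff_eq_mul.1 h1⟩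

end IsDoubleCover

/-- Every central extension of `E` by `ℤ/2` splits. -/
def SplitsModTwo (E : Type) [Group E] : Prop :=
  ∀ (D : Type) [Group D] (π : D →* E) (z : D), Function.Surjective π → IsDoubleCover π z →
    ∃ s : E →* D, ∀ x, π (s x) = x

/-! ### Lifting homomorphisms to double covers -/

/-- A group whose abelianization has odd order has no quotient of order two. -/
theorem hom_zmod_two_eq_one {E : Type} [Group E] (hE : Odd (Nat.card (Abelianization E)))
    (χ : E →* Multiplicative (ZMod 2)) (x : E) : χ x = 1 := by
  have h1 : χ x ^ Nat.card (Abelianization E) = 1 := by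
    rw [← Abelianization.lift_apply_of χ, ← map_pow, pow_card_eq_one', map_one]
  have h2 : χ x ^ 2 = 1 := by
    generalize χ x = a
    revert a; decide
  obtain ⟨k, hk⟩ := hE
  rw [hk, pow_succ, pow_mul, h2, one_pow, one_mul] at h1
  exact h1

section lift

variable {E E' G : Type} [Group E] [Group E'] [Group G] {d : E' →* G} {z : E'}

/-- Two lifts of a homomorphism to a double cover differ by a homomorphism to `ℤ/2`. -/
theorem IsDoubleCover.lift_unique (hd : IsDoubleCover d z)
    (hE : Odd (Nat.card (Abelianization E))) {l l' : E →* E'}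
    (h : ∀ x, d (l x) = d (l' x)) : l = l' := by
  choose a ha using fun x => hd.exists_eq_pow_mul (h x)
  let χ : E →* Multiplicative (ZMod 2) := MonoidHom.mk' (fun x => Multiplicative.ofAdd (a x)) <| by
    intro x y
    rw [← ofAdd_add]
    apply congrArg
    apply hd.pow_val_injective
    have h1 := ha (x * y)
    rw [map_mul, map_mul, ha x, ha y] at h1
    rw [hd.pow_val_add]
    have h2 := (hd.commute_pow (a y).val (l' x)).eq
    apply mul_right_cancel (b := l' x * l' y)
    rw [← h1]
    simp only [mul_assoc]
    rw [← mul_assoc (l' x), ← h2, mul_assoc]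
  ext x
  have hx : a x = 0 := hom_zmod_two_eq_one hE χ x
  rw [ha x, hx]
  simp

/-- A homomorphism from a group without non-split double covers lifts to a double cover. -/
theorem IsDoubleCover.exists_lift (hd : IsDoubleCover d z) (hE : SplitsModTwo E) (θ : E →* G)
    (hθ : ∀ x, ∃ y, d y = θ x) : ∃ l : E →* E', ∀ x, d (l x) = θ x := by
  -- split the pullback of the double cover along `θ`
  let D : Subgroup (E × E') := (θ.comp (MonoidHom.fst E E')).eqLocus (d.comp (MonoidHom.snd E E'))
  have hD : ∀ p, p ∈ D ↔ θ p.1 = d p.2 := fun p => Iff.rfl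
  obtain ⟨s, hs⟩ := hE D ((MonoidHom.fst E E').comp D.subtype)
    ⟨(1, z), by rw [hD]; simp [hd.map_z]⟩
    (fun x => by
      obtain ⟨y, hy⟩ := hθ x
      exact ⟨⟨(x, y), by rw [hD]; exact hy.symm⟩, rfl⟩)
    ⟨fun h => hd.ne_one (congrArg (fun p => p.1.2) h), fun p => by
      obtain ⟨⟨x, y⟩, hp⟩ := p
      rw [hD] at hp
      simp only [MonoidHom.comp_apply, Subgroup.subtype_apply, MonoidHom.coe_fst, Subtype.ext_iff,
        Subgroup.coe_one, Prod.ext_iff, Prod.fst_one, Prod.snd_one]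
      constructor
      · rintro rfl
        simp only [map_one] at hp
        rcases (hd.ker_iff y).1 hp.symm with h | h <;> simp [h]
      · rintro (h | h) <;> exact h.1⟩
  refine ⟨(MonoidHom.snd E E').comp (D.subtype.comp s), fun x => ?_⟩
  have h1 := (hD (s x).1).1 (s x).2
  have h2 : (s x).1.1 = x := hs x
  rw [h2] at h1
  exact h1.symm

end lift

/-! ### The crossed module of a double cover of a normal subgroup -/

section crossedModule

variable {E G : Type} [Group E] [Group G] {d : E →* G} {z : E}

theorem IsDoubleCover.exists_conj_lift (hd : IsDoubleCover d z) (hn : d.range.Normal)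
    (hE : SplitsModTwo E) (g : G) : ∃ l : E →* E, ∀ x, d (l x) = g * d x * g⁻¹ :=
  hd.exists_lift hE ((MulAut.conj g).toMonoidHom.comp d) fun x =>
    hn.conj_mem (d x) ⟨x, rfl⟩ g

/-- The conjugation action of `G` on the normal subgroup `d(E)` lifts uniquely to the double cover
`E`, provided that all central extensions of `E` by `ℤ/2` split and that `E` has no quotient of
order two. -/
noncomputable def IsDoubleCover.conjLift (hd : IsDoubleCover d z) (hn : d.range.Normal)
    (hE : SplitsModTwo E) (hab : Odd (Nat.card (Abelianization E))) : G →* MulAut E :=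
  let L : G → E →* E := fun g => (hd.exists_conj_lift hn hE g).choose
  have hL : ∀ g x, d (L g x) = g * d x * g⁻¹ := fun g => (hd.exists_conj_lift hn hE g).choose_spec
  have hmul : ∀ g h, (L g).comp (L h) = L (g * h) := fun g h =>
    hd.lift_unique hab fun x => by simp [hL, mul_assoc]
  have hone : L 1 = MonoidHom.id E := hd.lift_unique hab fun x => by simp [hL]
  { toFun := fun g => (L g).toMulEquiv (L g⁻¹) (by rw [hmul, inv_mul_cancel, hone])
      (by rw [hmul, mul_inv_cancel, hone])
    map_one' := by ext x; exact congrArg (fun l : E →* E => l x) hone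
    map_mul' := fun g h => by ext x; exact congrArg (fun l : E →* E => l x) (hmul g h).symm }

theorem IsDoubleCover.map_conjLift (hd : IsDoubleCover d z) (hn : d.range.Normal)
    (hE : SplitsModTwo E) (hab : Odd (Nat.card (Abelianization E))) (g : G) (x : E) :
    d (hd.conjLift hn hE hab g x) = g * d x * g⁻¹ :=
  (hd.exists_conj_lift hn hE g).choose_spec x

/-- The crossed module structure on a double cover of a normal subgroup. -/
noncomputable def IsDoubleCover.crossedModule (hd : IsDoubleCover d z) (hn : d.range.Normal)
    (hE : SplitsModTwo E) (hab : Odd (Nat.card (Abelianization E))) : CrossedModule E G where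
  d := d
  act := hd.conjLift hn hE hab
  d_act := hd.map_conjLift hn hE hab
  act_d := fun c c' => by
    have : (hd.conjLift hn hE hab (d c)).toMonoidHom = (MulAut.conj c).toMonoidHom :=
      hd.lift_unique hab fun x => by
        change d (hd.conjLift hn hE hab (d c) x) = d (c * x * c⁻¹)
        rw [hd.map_conjLift]; simp
    exact congrArg (fun l : E →* E => l c') this

end crossedModule

/-! ### Cocycles and central extensions by `ℤ/2` -/

/-- The central extension of `E` by `ℤ/2` which belongs to a 2-cocycle `u`, with multiplication
`(x, a) (y, b) = (x y, a + b + u(x, y))`. The cocycle need not be normalised: the unit is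
`(1, u(1, 1))`. -/
@[ext]
structure CocycleExtension {E : Type} [Group E] {u : E → E → ZMod 2} (hu : IsTwoCocycle u) where
  /-- The component in the group. -/
  base : E
  /-- The component in `ℤ/2`. -/
  fib : ZMod 2

namespace CocycleExtension

variable {E : Type} [Group E] {u : E → E → ZMod 2} (hu : IsTwoCocycle u)

instance : Mul (CocycleExtension hu) :=
  ⟨fun p q => ⟨p.base * q.base, p.fib + q.fib + u p.base q.base⟩⟩

instance : One (CocycleExtension hu) := ⟨⟨1, u 1 1⟩⟩

instance : Inv (CocycleExtension hu) := ⟨fun p => ⟨p.base⁻¹, u 1 1 - p.fib - u p.base⁻¹ p.base⟩⟩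

theorem mul_def (p q : CocycleExtension hu) :
    p * q = ⟨p.base * q.base, p.fib + q.fib + u p.base q.base⟩ := rfl

theorem one_def : (1 : CocycleExtension hu) = ⟨1, u 1 1⟩ := rfl

theorem inv_def (p : CocycleExtension hu) :
    p⁻¹ = ⟨p.base⁻¹, u 1 1 - p.fib - u p.base⁻¹ p.base⟩ := rfl

include hu in
theorem apply_one_left (x : E) : u 1 x = u 1 1 := by
  have := hu 1 1 x
  simp only [one_mul] at this
  linear_combination this

instance : Group (CocycleExtension hu) :=
  Group.ofLeftAxioms
    (fun p q r => by
      ext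
      · exact mul_assoc _ _ _
      · simp only [mul_def]
        linear_combination -hu p.base q.base r.base)
    (fun p => by
      have h2 : (2 : ZMod 2) = 0 := rfl
      ext
      · exact one_mul _
      · simp only [mul_def, one_def]
        linear_combination u 1 1 * h2 + apply_one_left hu p.base)
    (fun p => by
      ext
      · exact inv_mul_cancel _
      · simp only [mul_def, inv_def, one_def]
        ring)

/-- The projection of the central extension. -/
def proj : CocycleExtension hu →* E := MonoidHom.mk' base fun _ _ => rfl

theorem isDoubleCover_proj : IsDoubleCover (proj hu) ⟨1, u 1 1 + 1⟩ where
  ne_one := fun h => by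
    have : u 1 1 + 1 = u 1 1 := congrArg fib h
    simp at this
  ker_iff := fun ⟨x, a⟩ => by
    change x = 1 ↔ _
    have : ∀ a b : ZMod 2, a = b ∨ a = b + 1 := by decide
    simp only [one_def, CocycleExtension.mk.injEq, ← and_or_left, this, and_true]

end CocycleExtension

theorem SplitsModTwo.exists_primitive {E : Type} [Group E] (hE : SplitsModTwo E)
    {v : E → E → ZMod 2} (hv : IsTwoCocycle v) :
    ∃ β : E → ZMod 2, ∀ x y, v x y = β (x * y) - β x - β y := by
  obtain ⟨s, hs⟩ := hE _ (CocycleExtension.proj hv) _ (fun x => ⟨⟨x, 0⟩, rfl⟩)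
    (CocycleExtension.isDoubleCover_proj hv)
  refine ⟨fun x => (s x).fib, fun x y => ?_⟩
  have h1 : ∀ x, (s x).base = x := hs
  have h2 : (s (x * y)).fib = (s x).fib + (s y).fib + v (s x).base (s y).base :=
    congrArg CocycleExtension.fib (s.map_mul x y)
  rw [h1, h1] at h2
  simp only [h2]
  ring

section classification

variable {E P : Type} [Group E] [Group P] {d : E →* P} {z : E}

/-- The function `u` is the 2-cocycle of the double cover `d` for the section `σ`. -/
structure IsFactorSet (d : E →* P) (z : E) (σ : P → E) (u : P → P → ZMod 2) : Prop where
  section_eq : ∀ x, d (σ x) = x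
  mul_eq : ∀ x y, σ x * σ y = z ^ (u x y).val * σ (x * y)

theorem IsDoubleCover.exists_factorSet (hd : IsDoubleCover d z) (hs : Function.Surjective d) :
    ∃ σ u, IsFactorSet d z σ u := by
  choose σ hσ using hs
  choose u hu using fun x y => hd.exists_eq_pow_mul (x := σ x * σ y) (y := σ (x * y))
    (by simp [hσ])
  exact ⟨σ, u, hσ, hu⟩

variable {σ : P → E} {u : P → P → ZMod 2}

theorem IsFactorSet.isTwoCocycle (h : IsFactorSet d z σ u) (hd : IsDoubleCover d z) :
    IsTwoCocycle u := by
  intro x y t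
  apply hd.pow_val_injective
  apply mul_right_cancel (b := σ (x * y * t))
  rw [hd.pow_val_add, hd.pow_val_add]
  have h1 : σ x * (σ y * σ t) = z ^ (u y t).val * z ^ (u x (y * t)).val * σ (x * y * t) := by
    rw [h.mul_eq y t, ← mul_assoc, ← (hd.commute_pow _ (σ x)).eq, mul_assoc, h.mul_eq,
      ← mul_assoc x, ← mul_assoc]
  have h2 : σ x * σ y * σ t = z ^ (u (x * y) t).val * z ^ (u x y).val * σ (x * y * t) := by
    rw [h.mul_eq x y, mul_assoc, h.mul_eq, ← mul_assoc, ← (hd.commute_pow _ (z ^ _)).eq]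
  rw [← h1, ← h2, mul_assoc]

/-- The class of the double cover generates `H²(P, ℤ/2)`: a cocycle `v` of `P` becomes a coboundary
of some `β` on `E`, and `ε` is the value of `β` at `z`, normalised by `β 1 = 0`. -/
theorem IsFactorSet.exists_eq_mul_add (h : IsFactorSet d z σ u) (hd : IsDoubleCover d z)
    (hE : SplitsModTwo E) {v : P → P → ZMod 2} (hv : IsTwoCocycle v) :
    ∃ (ε : ZMod 2) (β : P → ZMod 2), ∀ x y, v x y = ε * u x y + (β x + β y - β (x * y)) := by
  obtain ⟨β, hβ⟩ := hE.exists_primitive (v := fun x y => v (d x) (d y))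
    (fun x y t => by simpa using hv (d x) (d y) (d t))
  refine ⟨β z + v 1 1, fun x => - β (σ x), fun x y => ?_⟩
  have h1 := hβ (σ x) (σ y)
  rw [h.mul_eq, h.section_eq, h.section_eq] at h1
  have h2 := hβ z (σ (x * y))
  rw [hd.map_z, CocycleExtension.apply_one_left hv] at h2
  obtain h0 | h0 := zmod_two_cases (u x y)
  · rw [h0] at h1 ⊢
    simp only [ZMod.val_zero, pow_zero, one_mul] at h1
    linear_combination h1
  · rw [h0] at h1 ⊢
    simp only [ZMod.val_one, pow_one] at h1
    linear_combination h1 - h2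

/-- A splitting of the double cover would give a homomorphism from `E` to its kernel. -/
theorem IsFactorSet.not_exists_primitive (h : IsFactorSet d z σ u) (hd : IsDoubleCover d z)
    (hab : Odd (Nat.card (Abelianization E))) :
    ¬ ∃ φ : P → ZMod 2, ∀ x y, u x y = φ x + φ y - φ (x * y) := by
  rintro ⟨φ, hφ⟩
  choose r hr using fun e => hd.exists_eq_pow_mul (x := e) (y := σ (d e)) (h.section_eq _).symm
  let χ : E →* Multiplicative (ZMod 2) :=
    MonoidHom.mk' (fun x => Multiplicative.ofAdd (r x + φ (d x))) <| by
      intro x y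
      rw [← ofAdd_add]
      apply congrArg
      have : r (x * y) = r x + r y + u (d x) (d y) := by
        apply hd.pow_val_injective
        apply mul_right_cancel (b := σ (d (x * y)))
        rw [← hr (x * y), hd.pow_val_add, hd.pow_val_add, mul_assoc, map_mul, ← h.mul_eq,
          mul_assoc, ← mul_assoc _ (σ (d x)), (hd.commute_pow _ (σ (d x))).eq, mul_assoc, ← hr y,
          ← mul_assoc, ← hr x]
      rw [this, hφ, map_mul]
      ring
  have hone : r 1 + φ (d 1) = 0 := hom_zmod_two_eq_one hab χ 1
  have hz : r z + φ (d z) = 0 := hom_zmod_two_eq_one hab χ z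
  rw [hd.map_z] at hz
  rw [map_one] at hone
  have h1 := hr 1
  have h2 := hr z
  rw [hd.map_z] at h2
  rw [map_one] at h1
  have : r 1 = r z := by linear_combination hone - hz
  exact hd.ne_one (by rw [h2, ← this, ← h1])

end classification

/-! ### Groups all of whose central extensions by `ℤ/2` split -/

open scoped commutatorElement

/-- If `S` normalises `W` and the commutators of `k` with `S` belong to `W`, then so do those with
the subgroup generated by `S`. -/
theorem commutatorElement_mem_of_mem_closure {D : Type*} [Group D] {S : Set D} {W : Subgroup D}
    (hS : ∀ s ∈ S, ∀ w ∈ W, s * w * s⁻¹ ∈ W ∧ s⁻¹ * w * s ∈ W) {k : D}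
    (hk : ∀ s ∈ S, ⁅k, s⁆ ∈ W) {g : D} (hg : g ∈ Subgroup.closure S) : ⁅k, g⁆ ∈ W := by
  have hN : ∀ g ∈ Subgroup.closure S, ∀ w ∈ W, g * w * g⁻¹ ∈ W ∧ g⁻¹ * w * g ∈ W := by
    intro g hg
    induction hg using Subgroup.closure_induction with
    | mem s hs => exact hS s hs
    | one => simp
    | mul x y _ _ hx hy =>
      intro w hw
      constructor
      · convert (hx _ (hy w hw).1).1 using 1; group
      · convert (hy _ (hx w hw).2).2 using 1; group
    | inv x _ hx =>
      intro w hw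
      rw [inv_inv]
      exact (hx w hw).symm
  induction hg using Subgroup.closure_induction with
  | mem s hs => exact hk s hs
  | one => simp
  | mul x y hx _ h1 h2 =>
    have : ⁅k, x * y⁆ = ⁅k, x⁆ * (x * ⁅k, y⁆ * x⁻¹) := by
      simp only [commutatorElement_def]; group
    rw [this]
    exact W.mul_mem h1 (hN x hx _ h2).1
  | inv x hx h1 =>
    have : ⁅k, x⁻¹⁆ = x⁻¹ * ⁅k, x⁆⁻¹ * x := by
      simp only [commutatorElement_def]; group
    rw [this]
    exact (hN x hx _ (W.inv_mem h1)).2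

theorem commutator_closure_le {D : Type*} [Group D] {S : Set D} {W : Subgroup D}
    (hS : ∀ s ∈ S, ∀ w ∈ W, s * w * s⁻¹ ∈ W ∧ s⁻¹ * w * s ∈ W)
    (hk : ∀ s ∈ S, ∀ t ∈ S, ⁅s, t⁆ ∈ W) : ⁅Subgroup.closure S, Subgroup.closure S⁆ ≤ W := by
  rw [Subgroup.commutator_le]
  intro g hg k hkk
  rw [← inv_mem_iff, commutatorElement_inv]
  refine commutatorElement_mem_of_mem_closure hS (fun s hs => ?_) hg
  rw [← inv_mem_iff, commutatorElement_inv]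
  exact commutatorElement_mem_of_mem_closure hS (hk s hs) hkk

/-- A double cover of `E` restricts to a central extension of the generalised quaternion group
`⟨x, y⟩` whose kernel meets the commutator subgroup trivially. For lifts `X`, `Y` the commutator
subgroup is generated by `w = ⁅Y, X⁆ = a X⁻²` with `a` in the kernel; as `w` has the same order `N`
as its image `x⁻²`, no power of `w` but `1` belongs to the kernel. -/
theorem IsDoubleCover.not_mem_commutator_of_quaternion {D E : Type} [Group D] [Group E] {π : D →* E}
    {z : D} (hz : IsDoubleCover π z) (hπ : Function.Surjective π) {x y : E} {N : ℕ} (hN : Even N)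
    (hyx : y * x * y⁻¹ = x⁻¹) (hxy : x ^ N = y ^ 2) (ho : orderOf x = 2 * N) :
    z ∉ ⁅(Subgroup.closure {x, y}).comap π, (Subgroup.closure {x, y}).comap π⁆ := by
  obtain ⟨X, rfl⟩ := hπ x
  obtain ⟨Y, rfl⟩ := hπ y
  obtain ⟨a, ha⟩ := hz.exists_eq_pow_mul (x := Y * X * Y⁻¹) (y := X⁻¹) (by simpa using hyx)
  obtain ⟨b, hb⟩ := hz.exists_eq_pow_mul (x := X ^ N) (y := Y ^ 2) (by simpa using hxy)
  set A := z ^ a.val with hA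
  have hAc : ∀ d, Commute A d := hz.commute_pow _
  have hA2 : A * A = 1 := by
    rw [hA, ← (Commute.refl z).mul_pow, hz.mul_self, one_pow]
  have hAi : A⁻¹ = A := inv_eq_of_mul_eq_one_left hA2
  set B := z ^ b.val with hB
  have hBc : ∀ d, Commute B d := hz.commute_pow _
  -- the commutator `⁅Y, X⁆`
  set w := A * (X⁻¹ * X⁻¹) with hw
  have hclos : (Subgroup.closure {π X, π Y}).comap π = Subgroup.closure {X, Y, z} := by
    have h1 : π.ker ≤ Subgroup.closure {X, Y, z} := by
      intro d hd
      rcases (hz.ker_iff d).1 hd with rfl | rfl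
      · exact one_mem _
      · exact Subgroup.subset_closure (by simp)
    have h2 : (Subgroup.closure {X, Y, z}).map π = Subgroup.closure {π X, π Y} := by
      rw [MonoidHom.map_closure, Set.image_insert_eq, Set.image_insert_eq, Set.image_singleton,
        hz.map_z]
      apply le_antisymm
      · rw [Subgroup.closure_le]
        rintro t (rfl | rfl | rfl)
        · exact Subgroup.subset_closure (by simp)
        · exact Subgroup.subset_closure (by simp)
        · exact one_mem _
      · apply Subgroup.closure_mono
        rintro t (rfl | rfl) <;> simp
    rw [← h2, Subgroup.comap_map_eq_self h1]
  rw [hclos]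
  have hXw : X * w * X⁻¹ = w := by
    rw [hw, ← mul_assoc, ← (hAc X).eq]; group
  have hYX : Y * X⁻¹ * Y⁻¹ = A * X := by
    have : Y * X⁻¹ * Y⁻¹ = (Y * X * Y⁻¹)⁻¹ := by group
    rw [this, ha, _root_.mul_inv_rev, inv_inv, hAi, (hAc X).eq]
  have hwi : w⁻¹ = A * (X * X) := by
    rw [hw, _root_.mul_inv_rev, hAi, _root_.mul_inv_rev, inv_inv, (hAc _).eq]
  have hYw : Y * w * Y⁻¹ = w⁻¹ := by
    have : Y * w * Y⁻¹ = A * ((Y * X⁻¹ * Y⁻¹) * (Y * X⁻¹ * Y⁻¹)) := by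
      rw [hw, ← mul_assoc, ← (hAc Y).eq]; group
    rw [this, hYX, hwi, mul_assoc A X, ← mul_assoc X, ← (hAc X).eq, mul_assoc A X, ← mul_assoc A A,
      hA2, one_mul]
  have hW : ⁅Subgroup.closure {X, Y, z}, Subgroup.closure {X, Y, z}⁆ ≤ Subgroup.zpowers w := by
    have hconj : ∀ s : D, (s * w * s⁻¹ = w ∨ s * w * s⁻¹ = w⁻¹) → ∀ v ∈ Subgroup.zpowers w,
        s * v * s⁻¹ ∈ Subgroup.zpowers w ∧ s⁻¹ * v * s ∈ Subgroup.zpowers w := by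
      rintro s hs v ⟨k, rfl⟩
      have h1 : s⁻¹ * w * s = w ∨ s⁻¹ * w * s = w⁻¹ := by
        rcases hs with hs | hs
        · left; nth_rewrite 1 [← hs]; group
        · right
          have : w = (s * w * s⁻¹)⁻¹ := by rw [hs, inv_inv]
          nth_rewrite 1 [this]; group
      have h2 : s⁻¹ * w ^ k * s = (s⁻¹ * w * s) ^ k := by
        have := (conj_zpow (a := s⁻¹) (b := w) (i := k)).symm
        simpa using this
      simp only [← conj_zpow, h2]
      constructor
      · rcases hs with hs | hs <;> rw [hs] <;> apply Subgroup.zpow_mem <;> simp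
      · rcases h1 with hs | hs <;> rw [hs] <;> apply Subgroup.zpow_mem <;> simp
    have hzc : ∀ d : D, ⁅d, z⁆ = 1 := fun d => by
      rw [commutatorElement_eq_one_iff_mul_comm]; exact (hz.commute d).eq.symm
    have hzc' : ∀ d : D, ⁅z, d⁆ = 1 := fun d => by
      rw [commutatorElement_eq_one_iff_mul_comm]; exact (hz.commute d).eq
    have hYXc : ⁅Y, X⁆ = w := by rw [commutatorElement_def, ha, hw, mul_assoc]
    have hXYc : ⁅X, Y⁆ = w⁻¹ := by rw [← commutatorElement_inv, hYXc]
    apply commutator_closure_le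
    · rintro s (rfl | rfl | rfl)
      · exact hconj _ (Or.inl hXw)
      · exact hconj _ (Or.inr hYw)
      · exact hconj _ (Or.inl (by rw [(hz.commute w).eq]; group))
    · rintro s (rfl | rfl | rfl) t (rfl | rfl | rfl) <;>
        simp [hzc, hzc', hYXc, hXYc]
  intro hmem
  obtain ⟨k, hk⟩ := hW hmem
  have hk : w ^ k = z := hk
  obtain ⟨M, hM⟩ := hN
  have hAN : A ^ N = 1 := by rw [hM, ← two_mul, pow_mul, pow_two, hA2, one_pow]
  have hX2 : X ^ N * X ^ N = 1 := by
    have h1 : Y * X ^ N * Y⁻¹ = X ^ N := by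
      rw [hb, ← mul_assoc, ← (hBc Y).eq]; group
    have h2 : Y * X ^ N * Y⁻¹ = (X ^ N)⁻¹ := by
      rw [← conj_pow, ha, (hAc _).mul_pow, hAN, one_mul, inv_pow]
    rw [h1] at h2
    nth_rewrite 1 [h2]
    simp
  have hwN : w ^ N = 1 := by
    rw [hw, (hAc _).mul_pow, hAN, one_mul, (Commute.refl X⁻¹).mul_pow, inv_pow,
      ← _root_.mul_inv_rev, hX2, inv_one]
  have hπw : π w = (π X) ^ (-2 : ℤ) := by
    rw [hw, map_mul, hA, hz.map_pow, one_mul, map_mul, map_inv]; group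
  have h3 : (π X) ^ (-2 * k : ℤ) = 1 := by
    rw [_root_.zpow_mul, ← hπw, ← map_zpow, hk, hz.map_z]
  rw [← orderOf_dvd_iff_zpow_eq_one, ho] at h3
  have h4 : (N : ℤ) ∣ k := by
    obtain ⟨c, hc⟩ := h3
    refine ⟨-c, ?_⟩
    push_cast at hc
    linarith
  obtain ⟨c, rfl⟩ := h4
  rw [_root_.zpow_mul, zpow_natCast, hwN, _root_.one_zpow] at hk
  exact hz.ne_one hk.symm

/-- A group which contains a generalised quaternion group as a subgroup of odd index, and whose
abelianization has odd order, has no non-split central extensions by `ℤ/2`. The proof uses the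
transfer to the preimage of the quaternion group. -/
theorem splitsModTwo_of_quaternion {E : Type} [Group E]
    (hab : Odd (Nat.card (Abelianization E))) {x y : E} {N : ℕ} (hN : Even N)
    (hyx : y * x * y⁻¹ = x⁻¹) (hxy : x ^ N = y ^ 2) (ho : orderOf x = 2 * N)
    (hidx : Odd (Subgroup.closure {x, y}).index) : SplitsModTwo E := by
  intro D _ π z hπ hz
  have hnot := hz.not_mem_commutator_of_quaternion hπ hN hyx hxy ho
  set K := (Subgroup.closure {x, y}).comap π with hK
  have hKi : K.index = (Subgroup.closure {x, y}).index := Subgroup.index_comap_of_surjective _ hπ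
  rw [← hKi] at hidx
  have : K.FiniteIndex := ⟨fun h => by rw [h] at hidx; exact absurd hidx (by decide)⟩
  have hzK : z ∈ K := by rw [hK, Subgroup.mem_comap, hz.map_z]; exact one_mem _
  have hpow : ∀ n, Odd n → z ^ n = z := by
    rintro _ ⟨n, rfl⟩
    rw [pow_succ, pow_mul, pow_two, hz.mul_self, one_pow, one_mul]
  -- by transfer to `K`, the element `z` is not in the commutator subgroup of `D`
  have hzD : z ∉ commutator D := by
    intro h
    have h1 : MonoidHom.transfer (Abelianization.of (G := K)) z = 1 :=
      Abelianization.commutator_subset_ker _ h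
    have h2 : ∀ k g, g⁻¹ * z ^ k * g = z ^ k := fun k g => by
      rw [mul_assoc, (hz.commute_pow k g).eq, inv_mul_cancel_left]
    rw [MonoidHom.transfer_eq_pow _ z (fun k g _ => h2 k g)] at h1
    have h3 : (⟨z, hzK⟩ : K) ∈ commutator K := by
      rw [← Abelianization.ker_of, MonoidHom.mem_ker, ← h1]
      congr 2
      exact (hpow _ hidx).symm
    apply hnot
    rw [← Subgroup.map_subtype_commutator]
    exact ⟨_, h3, rfl⟩
  set m := Nat.card (Abelianization E) with hm
  -- a homomorphism on `D` which restricts to the embedding of the kernel in `D_ab`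
  let ρ : D →* Abelianization D := (powMonoidHom m).comp Abelianization.of
  have hρ : ∀ d, ρ d = Abelianization.of (d ^ m) := fun d => by
    rw [map_pow]; rfl
  have hof : ∀ d : D, Abelianization.of d = 1 ↔ d ∈ commutator D := fun d => by
    rw [← MonoidHom.mem_ker, Abelianization.ker_of]
  have hρz : ρ z ≠ 1 := by
    rw [hρ, hpow m hab, Ne, hof]; exact hzD
  have hρd : ∀ d, ρ d = 1 ∨ ρ (z * d) = 1 := by
    intro d
    have h1 : π (d ^ m) ∈ commutator E := by
      rw [← Abelianization.ker_of, MonoidHom.mem_ker, map_pow, map_pow, hm]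
      exact pow_card_eq_one'
    have h2 : commutator E = (commutator D).map π := by
      rw [commutator_def, commutator_def, Subgroup.map_commutator, ← MonoidHom.range_eq_map,
        MonoidHom.range_eq_top.2 hπ]
    rw [h2] at h1
    obtain ⟨c, hc, hcd⟩ := h1
    obtain ⟨b, hb⟩ := hz.exists_eq_pow_mul hcd.symm
    obtain h0 | h0 := zmod_two_cases b
    · left
      rw [hρ, hof, hb, h0]
      simpa using hc
    · right
      rw [hρ, hof, (hz.commute d).mul_pow, hpow m hab, hb, h0, ← mul_assoc, ZMod.val_one, pow_one,
        hz.mul_self, one_mul]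
      exact hc
  -- the kernel of `ρ` is a complement
  have hbij : Function.Bijective (π.comp ρ.ker.subtype) := by
    constructor
    · rw [injective_iff_map_eq_one]
      rintro ⟨d, hd⟩ h
      rcases (hz.ker_iff d).1 h with rfl | rfl
      · rfl
      · exact absurd hd hρz
    · intro e
      obtain ⟨d, rfl⟩ := hπ e
      rcases hρd d with h | h
      · exact ⟨⟨d, h⟩, rfl⟩
      · exact ⟨⟨z * d, h⟩, by simp [hz.map_z]⟩
  let eq := MulEquiv.ofBijective _ hbij
  exact ⟨ρ.ker.subtype.comp eq.symm.toMonoidHom, fun e => eq.apply_symm_apply e⟩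

/-! ### The obstruction class of a double cover -/

theorem homology2Map_injective {P : Type} [Group P] (A : Type) [AddCommGroup A] (θ : MulAut P) :
    Function.Injective (homology2Map (P := P) A θ) := by
  let i := groupHomology.mapIso (A := Rep.trivial ℤ P A) (B := Rep.trivial ℤ P A) θ
    (LinearEquiv.refl ℤ A) (fun _ => rfl) 2
  exact (ConcreteCategory.bijective_of_isIso i.hom).1

/-- Three-cocycles with values in `ℤ/2` which differ by a coboundary have the same class. -/
theorem cohomology_class_eq_of_coboundary {H : Type} [Group H]
    (c c' : groupCohomology.cocycles (Rep.trivial ℤ H (ZMod 2)) 3) (b : H → H → ZMod 2)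
    (h : ∀ g h k, groupCohomology.iCocycles (Rep.trivial ℤ H (ZMod 2)) 3 c' ![g, h, k] =
      groupCohomology.iCocycles (Rep.trivial ℤ H (ZMod 2)) 3 c ![g, h, k] +
        (b h k - b (g * h) k + b g (h * k) - b g h)) :
    groupCohomology.π (Rep.trivial ℤ H (ZMod 2)) 3 c' =
      groupCohomology.π (Rep.trivial ℤ H (ZMod 2)) 3 c := by
  let A := Rep.trivial ℤ H (ZMod 2)
  let b' : (Fin 2 → H) → ZMod 2 := fun v => b (v 0) (v 1)
  let t : groupCohomology.cocycles A 3 := groupCohomology.toCocycles A 2 3 b'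
  have ht : groupCohomology.iCocycles A 3 t = inhomogeneousCochains.d A 2 b' := by
    have := congrArg (fun l => l b')
      ((groupCohomology.inhomogeneousCochains A).toCycles_i 2 3)
    refine this.trans ?_
    rw [groupCohomology.inhomogeneousCochains.d_def]
  have hd : ∀ g : Fin 3 → H, inhomogeneousCochains.d A 2 b' g =
      b (g 1) (g 2) - b (g 0 * g 1) (g 2) + b (g 0) (g 1 * g 2) - b (g 0) (g 1) := by
    intro g
    change (inhomogeneousCochains.d A 2).hom b' g = _
    rw [inhomogeneousCochains.d_hom_apply]
    have hs : ∀ v : Fin (2 + 1) → ZMod 2, ∑ j, v j = v 0 + v 1 + v 2 := Fin.sum_univ_three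
    refine (congrArg₂ (· + ·) rfl (hs _)).trans ?_
    simp [A, b', Fin.contractNth, Representation.trivial, CharTwo.sub_eq_add, add_assoc]
  have hc : c' = c + t := by
    apply (ModuleCat.mono_iff_injective (groupCohomology.iCocycles A 3)).1 inferInstance
    rw [map_add, ht]
    funext v
    have hv : v = ![v 0, v 1, v 2] := by
      ext i; fin_cases i <;> rfl
    refine (congrArg _ hv).trans ?_
    refine (h (v 0) (v 1) (v 2)).trans ?_
    rw [← hd, ← hv]
    rfl
  rw [hc, map_add]
  have : groupCohomology.π A 3 t = 0 :=
    congrArg (fun l => l b') ((groupCohomology.inhomogeneousCochains A).toCycles_comp_homologyπ 2 3)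
  rw [this, add_zero]

section obstruction

variable {G H E : Type} [Group G] [Group H] [Group E] {f : G →* H} {d : E →* G} {z : E}

/-- A homomorphism onto the kernel of `f`, as a map to that kernel. -/
def toKer (d : E →* G) (f : G →* H) (hr : d.range = f.ker) : E →* f.ker :=
  d.codRestrict f.ker fun x => hr ▸ ⟨x, rfl⟩

theorem toKer_surjective (hr : d.range = f.ker) : Function.Surjective (toKer d f hr) := by
  rintro ⟨y, hy⟩
  rw [← hr] at hy
  obtain ⟨x, rfl⟩ := hy
  exact ⟨x, rfl⟩

theorem IsDoubleCover.toKer (hd : IsDoubleCover d z) (hr : d.range = f.ker) :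
    IsDoubleCover (toKer d f hr) z where
  ne_one := hd.ne_one
  ker_iff x := by
    rw [← hd.ker_iff, Subtype.ext_iff]
    rfl

theorem odd_card_abelianization_of_surjective {P : Type} [Group P] {d : E →* P}
    (hd : Function.Surjective d) (hab : Odd (Nat.card (Abelianization E))) :
    Odd (Nat.card (Abelianization P)) := by
  refine Odd.of_dvd_nat hab (Subgroup.card_dvd_of_surjective (Abelianization.map d) ?_)
  intro y
  obtain ⟨y, rfl⟩ := QuotientGroup.mk_surjective y
  obtain ⟨x, rfl⟩ := hd y
  exact ⟨Abelianization.of x, rfl⟩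

section evalEquiv

variable {P : Type} [Group P] {d : E →* P} {σ : P → E} {u : P → P → ZMod 2}

/-- The isomorphism `H₂(P, ℤ/2) ≃ ℤ/2` given by the class of a double cover of `P`. -/
noncomputable def IsFactorSet.evalEquiv (h : IsFactorSet d z σ u) (hd : IsDoubleCover d z)
    (hE : SplitsModTwo E) (hab : Odd (Nat.card (Abelianization E))) :
    Homology2 P (ZMod 2) ≃+ ZMod 2 :=
  AddEquiv.ofBijective (evalH2 u (h.isTwoCocycle hd))
    ⟨evalH2_injective u _ fun _ hv => h.exists_eq_mul_add hd hE hv,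
      evalH2_surjective u _ (h.not_exists_primitive hd hab)⟩

theorem IsFactorSet.evalEquiv_coeffMap (h : IsFactorSet d z σ u) (hd : IsDoubleCover d z)
    (hE : SplitsModTwo E) (hab : Odd (Nat.card (Abelianization E)))
    (c : groupHomology.cycles₂ (Rep.trivial ℤ P ℤ)) :
    h.evalEquiv hd hE hab (coeffMap P (1 : ZMod 2) (groupHomology.H2π _ c)) = evalInt u c.1 :=
  evalH2_coeffMap u (h.isTwoCocycle hd) c

theorem nonempty_homology2_addEquiv (hs : Function.Surjective d) (hd : IsDoubleCover d z)
    (hE : SplitsModTwo E) (hab : Odd (Nat.card (Abelianization E))) :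
    Nonempty (Homology2 P (ZMod 2) ≃+ ZMod 2) := by
  obtain ⟨σ, u, h⟩ := hd.exists_factorSet hs
  exact ⟨h.evalEquiv hd hE hab⟩

end evalEquiv

/-- An injective endomorphism of a group of order two is the identity. -/
theorem addEquiv_zmod_two_map_eq {B : Type*} [AddCommGroup B] (e : B ≃+ ZMod 2) (l : B →+ B)
    (hl : Function.Injective l) (n : B) : l n = n := by
  apply e.injective
  by_cases hn : n = 0
  · rw [hn, map_zero]
  · have h1 : e n ≠ 0 := by simpa using hn
    have h2 : e (l n) ≠ 0 := by
      rw [Ne, EmbeddingLike.map_eq_zero_iff, map_eq_zero_iff l hl]; exact hn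
    rcases zmod_two_cases (e n) with h | h
    · exact absurd h h1
    · rcases zmod_two_cases (e (l n)) with h' | h'
      · exact absurd h' h2
      · rw [h, h']

/-- The homomorphism `n ↦ z ^ e(n)` to a double cover, for an additive map `e` to `ℤ/2`. It will be
used for an isomorphism `e` from `H₂`. -/
def IsDoubleCover.embed {B : Type} [AddCommGroup B] (hd : IsDoubleCover d z) (e : B →+ ZMod 2) :
    Multiplicative B →* E :=
  MonoidHom.mk' (fun n => z ^ (e n.toAdd).val) fun m n => by
    rw [toAdd_mul, map_add, hd.pow_val_add]

theorem IsDoubleCover.embed_ofAdd {B : Type} [AddCommGroup B] (hd : IsDoubleCover d z)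
    (e : B →+ ZMod 2) (n : B) :
    hd.embed e (Multiplicative.ofAdd n) = z ^ (e n).val := rfl

theorem IsDoubleCover.act_z (hd : IsDoubleCover d z) (X : CrossedModule E G) (hX : X.d = d)
    (g : G) : X.act g z = z := by
  have h1 : d (X.act g z) = 1 := by rw [← hX, X.d_act, hX, hd.map_z]; simp
  rcases (hd.ker_iff _).1 h1 with h | h
  · exact absurd ((map_eq_one_iff _ (X.act g).injective).1 h) hd.ne_one
  · exact h

/-- A crossed module structure on a double cover `E → ker f` is an obstruction crossed module, for
the identification of `H₂(ker f, ℤ/2)` with `{1, z}` by the class of the cover. -/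
theorem IsDoubleCover.isObstructionCrossedModule (hd : IsDoubleCover d z) (hr : d.range = f.ker)
    (hE : SplitsModTwo E) (hab : Odd (Nat.card (Abelianization E))) {σ : f.ker → E}
    {u : f.ker → f.ker → ZMod 2} (h : IsFactorSet (EmbeddingObstruction.toKer d f hr) z σ u)
    (X : CrossedModule E G) (hX : X.d = d) :
    IsObstructionCrossedModule f (1 : ZMod 2) X
      (hd.embed (h.evalEquiv (hd.toKer hr) hE hab).toAddMonoidHom) where
  injective_ι := fun m n hmn => by
    have h1 := hd.pow_val_injective hmn
    exact (h.evalEquiv (hd.toKer hr) hE hab).injective h1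
  range_ι := by
    set e := h.evalEquiv (hd.toKer hr) hE hab
    rw [hX]
    ext x
    constructor
    · rintro ⟨n, rfl⟩
      exact hd.map_pow _
    · intro hx
      obtain ⟨a, ha⟩ := hd.exists_eq_pow_mul (x := x) (y := 1) (by rw [map_one]; exact hx)
      refine ⟨Multiplicative.ofAdd (e.symm a), ?_⟩
      rw [hd.embed_ofAdd, ha, mul_one]
      exact congrArg (fun t : ZMod 2 => z ^ t.val) (e.apply_symm_apply a)
  range_d := by rw [hX, hr]
  act_ι := fun g n => by
    rw [hd.embed_ofAdd, hd.embed_ofAdd, _root_.map_pow, hd.act_z X hX]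
    have := addEquiv_zmod_two_map_eq (h.evalEquiv (hd.toKer hr) hE hab)
      (homology2Map (ZMod 2) (MulAut.conjNormal (H := f.ker) g)).hom.toAddMonoidHom
      (homology2Map_injective _ _) n
    exact congrArg (fun t => z ^ (h.evalEquiv (hd.toKer hr) hE hab t).val) this.symm
  class_eq := by
    set e := h.evalEquiv (hd.toKer hr) hE hab with he
    refine ⟨σ, fun x y => e.symm (u x y), fun x => ?_, fun x y => ?_, fun c => ?_⟩
    · rw [hX]; exact congrArg Subtype.val (h.section_eq x)
    · rw [h.mul_eq, hd.embed_ofAdd]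
      exact congrArg (fun t : ZMod 2 => z ^ t.val * _) (e.apply_symm_apply _).symm
    · refine (evalInt_apply (fun x y => e.symm (u x y)) c.1).symm.trans ?_
      apply e.injective
      rw [he, h.evalEquiv_coeffMap, ← he, evalInt_apply, evalInt_apply, Finsupp.sum, map_sum]
      simp only [map_zsmul, AddEquiv.apply_symm_apply]
      rfl

/-- Coboundaries vanish on cycles. -/
theorem evalInt_coboundary {P B : Type} [Group P] [AddCommGroup B] (φ : P → B)
    {c : P × P →₀ ℤ} (hc : c ∈ groupHomology.cycles₂ (Rep.trivial ℤ P ℤ)) :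
    evalInt (fun x y => φ x + φ y - φ (x * y)) c = 0 := by
  let D : (P × P →₀ ℤ) →+ (P →₀ ℤ) := (groupHomology.d₂₁ (Rep.trivial ℤ P ℤ)).hom.toAddMonoidHom
  let s : (P →₀ ℤ) →+ B := Finsupp.liftAddHom fun x => (smulAddHom ℤ B).flip (φ x)
  have hs : ∀ x n, s (Finsupp.single x n) = n • φ x := fun x n => by simp [s]
  have h : evalInt (fun x y => φ x + φ y - φ (x * y)) = s.comp D := by
    ext ⟨x, y⟩
    have hD : D (Finsupp.single (x, y) 1) = _ := d₂₁_trivial_single x y 1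
    simp only [AddMonoidHom.comp_apply, Finsupp.singleAddHom_apply, hD, map_add, map_sub, hs,
      evalInt_single, one_smul]
    abel
  have hD : D c = 0 := hc
  rw [h, AddMonoidHom.comp_apply, hD, map_zero]

/-- The crossed module of a double cover maps to every obstruction crossed module of `f`. -/
theorem IsDoubleCover.exists_lift_obstructionCrossedModule (hd : IsDoubleCover d z)
    (hr : d.range = f.ker) (hE : SplitsModTwo E) (hab : Odd (Nat.card (Abelianization E)))
    {σ : f.ker → E} {u : f.ker → f.ker → ZMod 2}
    (h : IsFactorSet (EmbeddingObstruction.toKer d f hr) z σ u)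
    {C : Type} [Group C] {X : CrossedModule C G}
    {ι : Multiplicative (Homology2 f.ker (ZMod 2)) →* C}
    (hX : IsObstructionCrossedModule f (1 : ZMod 2) X ι) :
    let e := h.evalEquiv (hd.toKer hr) hE hab
    let z' := ι (Multiplicative.ofAdd (e.symm 1))
    IsDoubleCover X.d z' ∧ ∃ θ : E →* C, (∀ x, X.d (θ x) = d x) ∧ θ z = z' := by
  intro e z'
  have hι : ∀ n, ι n = z' ^ (e n.toAdd).val := by
    intro n
    rcases zmod_two_cases (e n.toAdd) with h0 | h0
    · have : n = 1 := by
        have : n.toAdd = 0 := by simpa using h0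
        exact this
      rw [this]; simp
    · have : n = Multiplicative.ofAdd (e.symm 1) := by
        rw [← h0]; simp
      rw [h0, ZMod.val_one, pow_one, this]
  have hz' : IsDoubleCover X.d z' := by
    refine ⟨fun h1 => ?_, fun x => ?_⟩
    · have h2 := hX.injective_ι (h1.trans (map_one ι).symm)
      have h3 : e.symm 1 = 0 := h2
      rw [EmbeddingLike.map_eq_zero_iff] at h3
      exact one_ne_zero h3
    · rw [← MonoidHom.mem_ker, ← hX.range_ι]
      constructor
      · rintro ⟨n, rfl⟩
        rw [hι]
        rcases zmod_two_cases (e n.toAdd) with h0 | h0 <;> simp [h0, ZMod.val_one]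
      · rintro (rfl | rfl)
        · exact one_mem _
        · exact ⟨_, rfl⟩
  refine ⟨hz', ?_⟩
  obtain ⟨θ, hθ⟩ := hz'.exists_lift hE d (fun x => by
    have : d x ∈ X.d.range := by rw [hX.range_d, ← hr]; exact ⟨x, rfl⟩
    exact this)
  refine ⟨θ, hθ, ?_⟩
  rcases (hz'.ker_iff (θ z)).1 (by rw [hθ, hd.map_z]) with h1 | h1
  swap
  · exact h1
  -- otherwise the extension `C` would split over `f.ker`
  exfalso
  obtain ⟨σ', u', hσ', hu', hev⟩ := hX.class_eq
  let τ : f.ker → C := fun x => θ (σ x)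
  have hτ : ∀ x y, τ x * τ y = τ (x * y) := fun x y => by
    simp only [τ]
    rw [← map_mul, h.mul_eq, map_mul, _root_.map_pow, h1, one_pow, one_mul]
  have hdτ : ∀ x, X.d (τ x) = x := fun x => by
    rw [hθ]; exact congrArg Subtype.val (h.section_eq x)
  choose φ hφ using fun x => hz'.exists_eq_pow_mul (x := σ' x) (y := τ x) (by rw [hσ', hdτ])
  have hu'φ : ∀ x y, e (u' x y) = φ x + φ y - φ (x * y) := by
    intro x y
    have h2 := hu' x y
    rw [hι, toAdd_ofAdd, hφ x, hφ y, hφ (x * y)] at h2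
    have h3 : φ x + φ y = e (u' x y) + φ (x * y) := by
      apply hz'.pow_val_injective
      apply mul_right_cancel (b := τ (x * y))
      rw [hz'.pow_val_add, hz'.pow_val_add, mul_assoc (z' ^ (e (u' x y)).val), ← h2, ← hτ]
      simp only [mul_assoc]
      rw [← mul_assoc (τ x), ← (hz'.commute_pow _ (τ x)).eq, mul_assoc]
    linear_combination -h3
  refine h.not_exists_primitive (hd.toKer hr) hab
    (exists_primitive_of_evalInt_eq_zero (fun b => ?_)
      (odd_card_abelianization_of_surjective (toKer_surjective hr) hab) u fun c hc => ?_)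
  · revert b; decide
  · rw [← h.evalEquiv_coeffMap (hd.toKer hr) hE hab ⟨c, hc⟩, ← hev, ← evalInt_apply]
    have h2 : e (evalInt u' c) = evalInt (fun x y => φ x + φ y - φ (x * y)) c := by
      rw [evalInt_apply, evalInt_apply, Finsupp.sum, map_sum]
      simp only [map_zsmul, hu'φ]
      rfl
    exact h2.trans (evalInt_coboundary φ hc)

/-- The obstruction class may be computed from the crossed module of a double cover: the cocycle
`c'` of another obstruction crossed module, with another section `s'` and factor set `F'`, is
compared with the image of the factor set `K` of the double cover for the section `s'`. -/
theorem IsDoubleCover.isObstructionClass_iff (hd : IsDoubleCover d z)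
    (hr : d.range = f.ker) (hE : SplitsModTwo E) (hab : Odd (Nat.card (Abelianization E)))
    {σ : f.ker → E} {u : f.ker → f.ker → ZMod 2}
    (h : IsFactorSet (EmbeddingObstruction.toKer d f hr) z σ u)
    (X : CrossedModule E G) (hX : X.d = d) {s : H → G} {F : H → H → E}
    {c : groupCohomology.cocycles (Rep.trivial ℤ H (ZMod 2)) 3} (hs : ∀ h, f (s h) = h)
    (hF : ∀ g h, s g * s h = d (F g h) * s (g * h))
    {w : H → H → H → ZMod 2}
    (hw : ∀ g h k, groupCohomology.iCocycles (Rep.trivial ℤ H (ZMod 2)) 3 c ![g, h, k] = w g h k)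
    (hc : ∀ g h k, X.act (s g) (F h k) * F g (h * k) =
      z ^ (w g h k).val * (F g h * F (g * h) k)) (x : CohomologyMod2 H 3) :
    IsObstructionClass f (h.evalEquiv (hd.toKer hr) hE hab) x ↔
      x = groupCohomology.π (Rep.trivial ℤ H (ZMod 2)) 3 c := by
  set e := h.evalEquiv (hd.toKer hr) hE hab with he
  constructor
  swap
  · rintro rfl
    refine ⟨E, inferInstance, X, hd.embed e.toAddMonoidHom,
      hd.isObstructionCrossedModule hr hE hab h X hX, s, F, c, hs, by rwa [hX], ?_, rfl⟩
    intro g k l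
    rw [hc, hd.embed_ofAdd, hw]
    refine congrArg (fun t : ZMod 2 => z ^ t.val * _) ?_
    exact (e.apply_symm_apply _).symm
  · rintro ⟨C, _, X', ι, hX', s', F', c', hs', hF', hc', rfl⟩
    obtain ⟨hz', θ, hθ, hθz⟩ := hd.exists_lift_obstructionCrossedModule hr hE hab h hX'
    set z' := ι (Multiplicative.ofAdd (e.symm 1)) with hz'def
    have hι : ∀ a : ZMod 2, ι (Multiplicative.ofAdd (e.symm a)) = z' ^ a.val := by
      intro a
      rcases zmod_two_cases a with rfl | rfl <;> simp [hz'def, ZMod.val_one]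
    -- the map `θ` is equivariant
    have hact : ∀ g x, X'.act g (θ x) = θ (X.act g x) := by
      intro g
      have : (X'.act g).toMonoidHom.comp θ = θ.comp (X.act g).toMonoidHom :=
        hz'.lift_unique hab fun x => by
          change X'.d (X'.act g (θ x)) = X'.d (θ (X.act g x))
          rw [X'.d_act, hθ, hθ, ← hX, X.d_act]
      exact fun x => congrArg (fun l : E →* C => l x) this
    -- compare the sections `s` and `s'`
    have hτ : ∀ k, ∃ t, s' k = d t * s k := by
      intro k
      have : s' k * (s k)⁻¹ ∈ d.range := by
        rw [hr, MonoidHom.mem_ker, map_mul, map_inv, hs, hs', mul_inv_cancel]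
      obtain ⟨t, ht⟩ := this
      exact ⟨t, by rw [ht]; group⟩
    choose τ hτ using hτ
    let K : H → H → E := fun g k => τ g * X.act (s g) (τ k) * F g k * (τ (g * k))⁻¹
    have hK : ∀ g k, s' g * s' k = d (K g k) * s' (g * k) := by
      intro g k
      simp only [K, map_mul, map_inv, hτ]
      have h1 := X.d_act (s g) (τ k)
      rw [hX] at h1
      have h2 := hF g k
      rw [h1]
      calc d (τ g) * s g * (d (τ k) * s k)
          = d (τ g) * (s g * d (τ k) * (s g)⁻¹) * (s g * s k) := by group
        _ = _ := by rw [h2]; group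
    have hKc : ∀ g k l, X.act (s' g) (K k l) * K g (k * l) =
        z ^ (w g k l).val * (K g k * K (g * k) l) := by
      intro g k l
      have h1 : ∀ x, X.act (s' g) x = τ g * X.act (s g) x * (τ g)⁻¹ := by
        intro x
        rw [hτ, map_mul, MulAut.mul_apply, ← hX, X.act_d]
      have h2 : X.act (s g) (X.act (s k) (τ l)) =
          F g k * X.act (s (g * k)) (τ l) * (F g k)⁻¹ := by
        rw [← MulAut.mul_apply, ← map_mul, hF, map_mul, MulAut.mul_apply, ← hX, X.act_d]
      rw [h1]
      simp only [K, map_mul, map_inv, h2]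
      have h3 := hc g k l
      set v := z ^ (w g k l).val
      have hv : ∀ y, v * y = y * v := fun y => (hd.commute_pow _ y).eq
      rw [← mul_assoc g k l]
      calc _ = τ g * X.act (s g) (τ k) * (F g k * X.act (s (g * k)) (τ l) * (F g k)⁻¹) *
            (X.act (s g) (F k l) * F g (k * l)) * (τ (g * k * l))⁻¹ := by group
        _ = v * (τ g * X.act (s g) (τ k) * (F g k * X.act (s (g * k)) (τ l) * (F g k)⁻¹)) *
            (F g k * F (g * k) l) * (τ (g * k * l))⁻¹ := by
              rw [h3, hv (τ g * X.act (s g) (τ k) * _)]; simp only [mul_assoc]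
        _ = _ := by group
    clear_value K
    -- compare the factor sets `F'` and `θ ∘ K`
    choose b hb using fun g k => hz'.exists_eq_pow_mul (x := F' g k) (y := θ (K g k)) (by
      rw [hθ]
      have := (hF' g k).symm.trans (hK g k)
      exact mul_right_cancel this)
    refine cohomology_class_eq_of_coboundary c c' b fun g k l => ?_
    have h1 := hc' g k l
    rw [hι, hb, hb, hb, hb, map_mul, _root_.map_pow, hact] at h1
    have hz'a : X'.act (s' g) z' = z' := hz'.act_z X' rfl _
    rw [hz'a] at h1
    have h2 := congrArg θ (hKc g k l)
    rw [map_mul, map_mul, map_mul, _root_.map_pow, hθz] at h2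
    rw [hw]
    set v : ZMod 2 := groupCohomology.iCocycles (Rep.trivial ℤ H (ZMod 2)) 3 c' ![g, k, l]
    have hcom : ∀ (a : ZMod 2) y, y * z' ^ a.val = z' ^ a.val * y :=
      fun a y => (hz'.commute_pow _ y).eq.symm
    have h3 : b k l + b g (k * l) + w g k l = v + (b g k + b (g * k) l) := by
      apply hz'.pow_val_injective
      apply mul_right_cancel (b := θ (K g k) * θ (K (g * k) l))
      simp only [hz'.pow_val_add]
      have h4 : ∀ (a a' : ZMod 2) (x y : C), z' ^ a.val * x * (z' ^ a'.val * y) =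
          z' ^ a.val * z' ^ a'.val * (x * y) := fun a a' x y => by
        rw [mul_assoc, ← mul_assoc x, hcom]; simp only [mul_assoc]
      rw [h4, h4, h2] at h1
      simpa only [mul_assoc] using h1
    linear_combination -h3

end obstruction

/-- A criterion for the property `(∗)_b`: the kernel of `f` has a double cover `E` of which all
central extensions by `ℤ/2` split, and the failure of associativity of a factor set with values in
`E` is the cochain `a ∪ a ∪ b`. -/
theorem exhibitsStarB_of_doubleCover {G E : Type} [Group G] [Finite G] [Group E] {f : G →* V4}
    {d : E →* G} {z : E} (hd : IsDoubleCover d z) (hr : d.range = f.ker) (hE : SplitsModTwo E)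
    (hE' : Odd (Nat.card (Abelianization E))) {a b : Additive V4 →+ ZMod 2} (ha : a ≠ 0)
    (hb : b ≠ 0) (hab : a ≠ b) {s : V4 → G} {F : V4 → V4 → E} (hs : ∀ h, f (s h) = h)
    (hF : ∀ g h, s g * s h = d (F g h) * s (g * h))
    (hc : ∀ L : V4 → E →* E, (∀ g x, d (L g x) = s g * d x * (s g)⁻¹) →
      ∀ g h k, L g (F h k) * F g (h * k) =
        z ^ (a (.ofMul g) * a (.ofMul h) * b (.ofMul k)).val * (F g h * F (g * h) k)) :
    ExhibitsStarB f where
  finite := inferInstance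
  surjective := fun h => ⟨s h, hs h⟩
  odd_ab := odd_card_abelianization_of_surjective (toKer_surjective hr) hE'
  obstruction := by
    have hn : d.range.Normal := hr ▸ inferInstance
    let X := hd.crossedModule hn hE hE'
    obtain ⟨σ, u, h⟩ := (hd.toKer hr).exists_factorSet (toKer_surjective hr)
    let I := groupCohomology.H1IsoOfIsTrivial (Rep.trivial ℤ V4 (ZMod 2))
    have hI : ∀ t, homOfClass (I.inv t) = t := fun t => congrArg (fun l => l t) I.inv_hom_id
    have h0 : homOfClass (0 : CohomologyMod2 V4 1) = 0 := map_zero I.hom.hom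
    refine ⟨h.evalEquiv (hd.toKer hr) hE hE', I.inv a, I.inv b, ?_, ?_, ?_, ?_⟩
    · intro h1
      exact ha (by rw [← hI a, h1, h0])
    · intro h1
      exact hb (by rw [← hI b, h1, h0])
    · intro h1
      exact hab (by rw [← hI a, h1, hI])
    · ext x
      refine hd.isObstructionClass_iff hr hE hE' h X rfl hs hF
        (w := fun g h k => a (.ofMul g) * a (.ofMul h) * b (.ofMul k)) (fun g h k => ?_)
        (hc (fun g => (X.act (s g)).toMonoidHom) fun g x => X.d_act (s g) x) x
      refine (congrFun (groupCohomology.iCocycles_mk _ (tripleCupCochain_d _ _ _)) _).trans ?_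
      simp [tripleCupCochain, hI]

/-! ### The group `SL(2, F)` -/

section SL2

variable {F : Type} [Field F]

/-- The matrix `(1 x; 0 1)`. -/
def upper (x : F) : SL(2, F) := ⟨!![1, x; 0, 1], by simp [det_fin_two]⟩

/-- The matrix `(1 0; x 1)`. -/
def lower (x : F) : SL(2, F) := ⟨!![1, 0; x, 1], by simp [det_fin_two]⟩

/-- The diagonal torus `t ↦ diag(t, t⁻¹)`. -/
def torus : Fˣ →* SL(2, F) :=
  MonoidHom.mk' (fun t => ⟨!![(t : F), 0; 0, ((t⁻¹ : Fˣ) : F)], by simp [det_fin_two]⟩)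
    fun s t => by
      apply Subtype.ext
      change _ = !![(s : F), 0; 0, ((s⁻¹ : Fˣ) : F)] * !![(t : F), 0; 0, ((t⁻¹ : Fˣ) : F)]
      simp [mul_comm]

/-- The matrix `(0 1; -1 0)`. -/
def weyl : SL(2, F) := ⟨!![0, 1; -1, 0], by simp [det_fin_two]⟩

theorem coe_upper (x : F) : (upper x : Matrix (Fin 2) (Fin 2) F) = !![1, x; 0, 1] := rfl

theorem coe_lower (x : F) : (lower x : Matrix (Fin 2) (Fin 2) F) = !![1, 0; x, 1] := rfl

theorem coe_torus (t : Fˣ) : (torus t : Matrix (Fin 2) (Fin 2) F) =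
    !![(t : F), 0; 0, ((t⁻¹ : Fˣ) : F)] := rfl

theorem coe_weyl : ((weyl : SL(2, F)) : Matrix (Fin 2) (Fin 2) F) = !![0, 1; -1, 0] := rfl

theorem torus_injective : Function.Injective (torus : Fˣ → SL(2, F)) := by
  intro s t h
  have := congrArg (fun A : SL(2, F) => A 0 0) h
  exact Units.ext (by simpa [coe_torus] using this)

theorem weyl_mul_torus (t : Fˣ) : weyl * torus t * weyl⁻¹ = (torus t)⁻¹ := by
  rw [mul_inv_eq_iff_eq_mul, ← map_inv]
  ext i j
  fin_cases i <;> fin_cases j <;> simp [coe_torus, coe_weyl]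

theorem weyl_sq : (weyl : SL(2, F)) ^ 2 = torus (-1) := by
  rw [pow_two]
  ext i j
  fin_cases i <;> fin_cases j <;> simp [coe_torus, coe_weyl]

theorem weyl_notMem_range_torus : (weyl : SL(2, F)) ∉ (torus : Fˣ →* SL(2, F)).range := by
  rintro ⟨t, ht⟩
  have := congrArg (fun A : SL(2, F) => A 0 0) ht
  simp [coe_torus, coe_weyl] at this

theorem torus_neg_one_ne_one (h2 : (2 : F) ≠ 0) : torus (-1 : Fˣ) ≠ 1 := by
  intro h
  have := torus_injective (h.trans (map_one torus).symm)
  have h1 : (-1 : F) = 1 := congrArg Units.val this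
  apply h2
  linear_combination -h1

theorem mem_center_SL2_iff (A : SL(2, F)) :
    A ∈ Subgroup.center SL(2, F) ↔ A = 1 ∨ A = torus (-1) := by
  rw [Matrix.SpecialLinearGroup.mem_center_iff]
  constructor
  · rintro ⟨r, hr, hA⟩
    have h : r = 1 ∨ r = -1 := mul_self_eq_one_iff.1 (by simpa [pow_two] using hr)
    rcases h with rfl | rfl
    · left
      ext i j
      rw [← hA]; simp
    · right
      ext i j
      rw [← hA]
      fin_cases i <;> fin_cases j <;> simp [coe_torus]
  · rintro (rfl | rfl)
    · exact ⟨1, by simp, by simp⟩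
    · refine ⟨-1, by simp, ?_⟩
      ext i j
      fin_cases i <;> fin_cases j <;> simp [coe_torus]

theorem commutator_SL2_eq_top [Finite F] (hF : 4 < Nat.card F) : commutator SL(2, F) = ⊤ := by
  obtain ⟨a, ha0, ha⟩ : ∃ a : F, a ≠ 0 ∧ a ^ 2 ≠ 1 := by
    classical
    by_contra! h
    have : (Set.univ : Set F) ⊆ ({0, 1, -1} : Finset F) := by
      intro a _
      by_cases h0 : a = 0
      · simp [h0]
      · rcases (mul_self_eq_one_iff (a := a)).1 (by rw [← pow_two, h a h0]) with h1 | h1 <;>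
          simp [h1]
    have h1 := Set.ncard_le_ncard this
    rw [Set.ncard_univ, Set.ncard_coe_finset] at h1
    have h2 : ({0, 1, -1} : Finset F).card ≤ 3 := Finset.card_le_three
    omega
  exact SL2.commutator_eq_top ha0 ha

theorem natCard_abelianization_eq_one {E : Type} [Group E] (h : commutator E = ⊤) :
    Nat.card (Abelianization E) = 1 := by
  rw [Nat.card_eq_one_iff_unique]
  refine ⟨⟨fun a b => ?_⟩, ⟨1⟩⟩
  have : ∀ a : Abelianization E, a = 1 := by
    intro a
    obtain ⟨x, rfl⟩ := QuotientGroup.mk_surjective a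
    exact (QuotientGroup.eq_one_iff x).2 (h ▸ Subgroup.mem_top x)
  rw [this a, this b]

theorem natCard_SL2 [Finite F] :
    Nat.card SL(2, F) = Nat.card F * (Nat.card F - 1) * (Nat.card F + 1) := by
  have := Fintype.ofFinite F
  have h1 : Nat.card (GL (Fin 2) F) = (Nat.card F ^ 2 - 1) * (Nat.card F ^ 2 - Nat.card F) := by
    rw [Matrix.card_GL_field, Fin.prod_univ_two]
    simp
  let D : GL (Fin 2) F →* Fˣ := Matrix.GeneralLinearGroup.det
  have hD : Function.Surjective D := Matrix.GeneralLinearGroup.det_surjective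
  have h2 : Nat.card D.ker = Nat.card SL(2, F) := by
    have : (Matrix.SpecialLinearGroup.toGL : SL(2, F) →* GL (Fin 2) F).range = D.ker := by
      ext g
      constructor
      · rintro ⟨A, rfl⟩
        simp [D]
      · intro hg
        refine ⟨⟨g, ?_⟩, ?_⟩
        · have := congrArg Units.val (MonoidHom.mem_ker.1 hg)
          simpa [D] using this
        · ext; rfl
    rw [← this]
    exact (Nat.card_congr (MonoidHom.ofInjective
      Matrix.SpecialLinearGroup.toGL_injective).toEquiv).symm
  have h3 : Nat.card D.ker * Nat.card Fˣ = Nat.card (GL (Fin 2) F) := by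
    rw [← Subgroup.card_mul_index D.ker, Subgroup.index_ker, MonoidHom.range_eq_top.2 hD,
      Subgroup.card_top]
  have h4 : Nat.card Fˣ = Nat.card F - 1 := by
    rw [Nat.card_units]
  have hq : 2 ≤ Nat.card F := by
    have := Finite.one_lt_card (α := F); omega
  rw [h2, h1, h4] at h3
  obtain ⟨k, hk⟩ := Nat.exists_eq_add_of_le hq
  rw [hk] at h3 ⊢
  have e1 : (2 + k) ^ 2 - 1 = (k + 1) * (k + 3) := by
    have : (2 + k) ^ 2 = (k + 1) * (k + 3) + 1 := by ring
    omega
  have e2 : (2 + k) ^ 2 - (2 + k) = (k + 2) * (k + 1) := by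
    have : (2 + k) ^ 2 = (k + 2) * (k + 1) + (2 + k) := by ring
    omega
  have e3 : 2 + k - 1 = k + 1 := by omega
  rw [e1, e2, e3] at h3
  rw [e3]
  apply Nat.eq_of_mul_eq_mul_right (show 0 < k + 1 by omega)
  rw [h3]; ring

/-- If `y` normalises `T` and has order two modulo `T`, the index of `T` in a larger group which
contains `y` is even. -/
theorem even_relIndex_of_mem {G : Type*} [Group G] {T S : Subgroup G} (hTS : T ≤ S) {y : G}
    (hyS : y ∈ S) (hyT : y ∉ T) (hy2 : y * y ∈ T) (hn : ∀ t ∈ T, y * t * y⁻¹ ∈ T) :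
    Even (T.relIndex S) := by
  have hy2' : y⁻¹ * y⁻¹ ∈ T := by simpa using T.inv_mem hy2
  have hn' : ∀ t ∈ T, y⁻¹ * t * y ∈ T := by
    intro t ht
    have h1 : y⁻¹ * t * y = (y⁻¹ * y⁻¹) * (y * t * y⁻¹) * (y * y) := by group
    rw [h1]
    exact T.mul_mem (T.mul_mem hy2' (hn t ht)) hy2
  let K : Subgroup G :=
    { carrier := {g | g ∈ T ∨ g * y ∈ T}
      one_mem' := Or.inl T.one_mem
      mul_mem' := by
        rintro a b (ha | ha) (hb | hb)
        · exact Or.inl (T.mul_mem ha hb)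
        · right; rw [mul_assoc]; exact T.mul_mem ha hb
        · right
          have : a * b * y = (a * y) * (y⁻¹ * b * y) := by group
          rw [this]; exact T.mul_mem ha (hn' b hb)
        · left
          have : a * b = (a * y) * (y⁻¹ * (b * y) * y) * (y⁻¹ * y⁻¹) := by group
          rw [this]; exact T.mul_mem (T.mul_mem ha (hn' _ hb)) hy2'
      inv_mem' := by
        rintro a (ha | ha)
        · exact Or.inl (T.inv_mem ha)
        · right
          have : a⁻¹ * y = y * (a * y)⁻¹ * y⁻¹ * (y * y) := by group
          rw [this]; exact T.mul_mem (hn _ (T.inv_mem ha)) hy2 }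
  have hTK : T ≤ K := fun t ht => Or.inl ht
  have hyK : y ∈ K := Or.inr hy2
  have hKS : K ≤ S := by
    rintro g (hg | hg)
    · exact hTS hg
    · have : g = g * y * y⁻¹ := by group
      rw [this]; exact S.mul_mem (hTS hg) (S.inv_mem hyS)
  have h2 : T.relIndex K = 2 := by
    rw [Subgroup.relIndex_eq_two_iff]
    refine ⟨y, hyK, ?_⟩
    rintro b (hb | hb)
    · right
      refine ⟨hb, fun h => hyT ?_⟩
      simpa using T.mul_mem (T.inv_mem hb) h
    · left
      refine ⟨hb, fun h => hyT ?_⟩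
      simpa using T.mul_mem (T.inv_mem h) hb
  rw [← Subgroup.relIndex_mul_relIndex T K S hTK hKS, h2]
  exact even_two_mul _

/-- The subgroup generated by the torus and `weyl` has odd index `|F| (|F| + 1) / 2`. -/
theorem odd_index_closure_torus_weyl [Finite F] (hF : Nat.card F % 4 = 1) {ν : Fˣ}
    (hν : ∀ t, t ∈ Subgroup.zpowers ν) :
    Odd (Subgroup.closure {torus ν, (weyl : SL(2, F))}).index := by
  set S := Subgroup.closure {torus ν, (weyl : SL(2, F))}
  set T := (torus : Fˣ →* SL(2, F)).range with hT
  have hq : 1 < Nat.card F := Finite.one_lt_card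
  have hTS : T ≤ S := by
    rintro _ ⟨t, rfl⟩
    obtain ⟨n, rfl⟩ := hν t
    rw [map_zpow]
    exact S.zpow_mem (Subgroup.subset_closure (by simp)) n
  have h1 : Even (T.relIndex S) :=
    even_relIndex_of_mem hTS (Subgroup.subset_closure (by simp)) weyl_notMem_range_torus
      ⟨-1, by rw [← weyl_sq, pow_two]⟩ (by
        rintro _ ⟨t, rfl⟩
        rw [weyl_mul_torus]
        exact T.inv_mem ⟨t, rfl⟩)
  have hcT : Nat.card T = Nat.card F - 1 := by
    rw [← Nat.card_units]
    exact (Nat.card_congr (MonoidHom.ofInjective torus_injective).toEquiv).symm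
  have h2 : T.index = Nat.card F * (Nat.card F + 1) := by
    have := T.card_mul_index
    rw [hcT, natCard_SL2] at this
    apply Nat.eq_of_mul_eq_mul_left (show 0 < Nat.card F - 1 by omega)
    rw [this]; ring
  have h3 := Subgroup.relIndex_mul_index hTS
  rw [h2] at h3
  rw [← Nat.not_even_iff_odd]
  intro h4
  obtain ⟨a, ha⟩ := h1
  obtain ⟨b, hb⟩ := h4
  obtain ⟨c, hc⟩ : ∃ c, Nat.card F = 4 * c + 1 := ⟨Nat.card F / 4, by omega⟩
  rw [ha, hb, hc] at h3
  have : 4 * (a * b) = 4 * (4 * c * c + 3 * c) + 2 := by linarith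
  omega

end SL2

theorem two_ne_zero_of_odd_card {F : Type} [Field F] (hF : Nat.card F % 4 = 1) :
    (2 : F) ≠ 0 := by
  intro h
  have : addOrderOf (1 : F) = 2 :=
    addOrderOf_eq_prime (by rw [nsmul_one]; exact_mod_cast h) one_ne_zero
  have h2 := addOrderOf_dvd_natCard (1 : F)
  rw [this] at h2
  omega

section SL2Split

variable {F : Type} [Field F] [Finite F]

/-- A generator of `Fˣ` has `-1` as its power of exponent `(|F| - 1) / 2`. -/
theorem pow_half_eq_neg_one {ν : Fˣ} (hν : ∀ t, t ∈ Subgroup.zpowers ν) {N : ℕ}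
    (hN : Nat.card F = 2 * N + 1) : ν ^ N = -1 := by
  have ho : orderOf ν = 2 * N := by
    rw [orderOf_eq_card_of_forall_mem_zpowers hν, Nat.card_units, hN]; rfl
  have h1 : (ν ^ N) * (ν ^ N) = 1 := by
    rw [← pow_add, ← two_mul, ← ho, pow_orderOf_eq_one]
  have hne : ν ^ N ≠ 1 := by
    intro h
    have h3 := orderOf_dvd_of_pow_eq_one h
    rw [ho] at h3
    have h4 : 1 < Nat.card F := Finite.one_lt_card
    have := Nat.le_of_dvd (by omega) h3
    omega
  have h5 : ((ν ^ N : Fˣ) : F) = 1 ∨ ((ν ^ N : Fˣ) : F) = -1 :=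
    mul_self_eq_one_iff.1 (congrArg Units.val h1)
  rcases h5 with h | h
  · exact absurd (Units.ext h) hne
  · exact Units.ext h

/-- A finite group with odd abelianization which contains `SL(2, F)`, `|F| = 1` modulo four, as a
subgroup of odd index has no non-split central extension by `ℤ/2`. -/
theorem splitsModTwo_of_SL2 (hF : Nat.card F % 4 = 1) {E : Type} [Group E]
    (hab : Odd (Nat.card (Abelianization E))) (i : SL(2, F) →* E) (hi : Function.Injective i)
    (hidx : Odd i.range.index) : SplitsModTwo E := by
  obtain ⟨ν, hν⟩ := IsCyclic.exists_generator (α := Fˣ)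
  obtain ⟨k, hk⟩ : ∃ k, Nat.card F = 4 * k + 1 := ⟨Nat.card F / 4, by omega⟩
  have hN : Nat.card F = 2 * (2 * k) + 1 := by omega
  refine splitsModTwo_of_quaternion hab (x := i (torus ν)) (y := i weyl) (N := 2 * k)
    (even_two_mul k) ?_ ?_ ?_ ?_
  · rw [← map_mul, ← map_inv, ← map_mul, weyl_mul_torus, map_inv]
  · rw [← map_pow, ← map_pow, ← map_pow, pow_half_eq_neg_one hν hN,
      weyl_sq]
  · rw [orderOf_injective i hi, orderOf_injective torus torus_injective,
      orderOf_eq_card_of_forall_mem_zpowers hν, Nat.card_units, hN]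
    rfl
  · have : Subgroup.closure {i (torus ν), i weyl} =
        (Subgroup.closure {torus ν, (weyl : SL(2, F))}).map i := by
      rw [MonoidHom.map_closure, Set.image_insert_eq, Set.image_singleton]
    rw [this, Subgroup.index_map, (MonoidHom.ker_eq_bot_iff i).2 hi, sup_bot_eq]
    exact (odd_index_closure_torus_weyl hF hν).mul hidx

theorem odd_card_abelianization_SL2 (hF : 4 < Nat.card F) :
    Odd (Nat.card (Abelianization SL(2, F))) := by
  rw [natCard_abelianization_eq_one (commutator_SL2_eq_top hF)]
  exact odd_one

theorem splitsModTwo_SL2 (hF : Nat.card F % 4 = 1) (hF4 : 4 < Nat.card F) :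
    SplitsModTwo SL(2, F) :=
  splitsModTwo_of_SL2 hF (odd_card_abelianization_SL2 hF4) (MonoidHom.id _)
    Function.injective_id (by rw [MonoidHom.range_eq_top.2 Function.surjective_id]; simp)

variable {Γ : Type} [Group Γ] (φ : Γ →* MulAut SL(2, F))

theorem odd_card_abelianization_semidirect (hF : 4 < Nat.card F) (hΓ : Odd (Nat.card Γ)) :
    Odd (Nat.card (Abelianization (SL(2, F) ⋊[φ] Γ))) := by
  refine Odd.of_dvd_nat hΓ (Subgroup.card_dvd_of_surjective
    (Abelianization.of.comp (SemidirectProduct.inr : Γ →* SL(2, F) ⋊[φ] Γ)) ?_)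
  intro y
  obtain ⟨x, rfl⟩ := QuotientGroup.mk_surjective y
  refine ⟨x.right, ?_⟩
  have h1 : ∀ M : SL(2, F), Abelianization.of (SemidirectProduct.inl M : SL(2, F) ⋊[φ] Γ) = 1 := by
    intro M
    have hM : M ∈ commutator SL(2, F) := by rw [commutator_SL2_eq_top hF]; trivial
    exact Abelianization.commutator_subset_ker
      (Abelianization.of.comp (SemidirectProduct.inl : SL(2, F) →* SL(2, F) ⋊[φ] Γ)) hM
  change Abelianization.of (SemidirectProduct.inr x.right) = Abelianization.of x
  conv_rhs => rw [← SemidirectProduct.inl_left_mul_inr_right x, map_mul, h1, one_mul]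

theorem splitsModTwo_semidirect (hF : Nat.card F % 4 = 1) (hF4 : 4 < Nat.card F)
    (hΓ : Odd (Nat.card Γ)) : SplitsModTwo (SL(2, F) ⋊[φ] Γ) := by
  refine splitsModTwo_of_SL2 hF (odd_card_abelianization_semidirect φ hF4 hΓ)
    SemidirectProduct.inl SemidirectProduct.inl_injective ?_
  rw [SemidirectProduct.range_inl_eq_ker_rightHom, Subgroup.index_ker,
    MonoidHom.range_eq_top.2 SemidirectProduct.rightHom_surjective, Subgroup.card_top]
  exact hΓ

end SL2Split

/-! ### Actions on `GL(2, F)` and `SL(2, F)` -/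

section PGL

variable {F : Type} [Field F]

/-- The action of field automorphisms on `SL(2, F)`, entry by entry. -/
def slAut (F : Type) [Field F] : (F ≃+* F) →* MulAut SL(2, F) where
  toFun σ := (Matrix.SpecialLinearGroup.map (n := Fin 2) (σ : F →+* F)).toMulEquiv
    (Matrix.SpecialLinearGroup.map (σ.symm : F →+* F))
    (by ext A i j; simp) (by ext A i j; simp)
  map_one' := by ext A i j; rfl
  map_mul' σ τ := by ext A i j; rfl

theorem slAut_apply (σ : F ≃+* F) (A : SL(2, F)) (i j : Fin 2) : slAut F σ A i j = σ (A i j) := rfl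

theorem pglAut_mk (σ : F ≃+* F) (g : GL (Fin 2) F) :
    pglAut F σ (ProjGenLinGroup.mk g) = ProjGenLinGroup.mk (glAut F σ g) := rfl

theorem glAut_toGL (σ : F ≃+* F) (A : SL(2, F)) :
    glAut F σ (SpecialLinearGroup.toGL A) = SpecialLinearGroup.toGL (slAut F σ A) := by
  ext i j; rfl

theorem det_glAut (σ : F ≃+* F) (g : GL (Fin 2) F) : GeneralLinearGroup.det (glAut F σ g) =
    Units.mapEquiv σ.toMulEquiv (GeneralLinearGroup.det g) := by
  ext
  simp only [GeneralLinearGroup.val_det_apply]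
  exact (RingEquiv.map_det σ g.1).symm

/-- Conjugation of `SL(2, F)` by elements of `GL(2, F)`. -/
def slConj (F : Type) [Field F] : GL (Fin 2) F →* MulAut SL(2, F) where
  toFun g :=
    { toFun := fun A => ⟨g.1 * A.1 * g.2, by
        rw [det_mul, det_mul, A.2, mul_one, ← det_mul, g.val_inv, det_one]⟩
      invFun := fun A => ⟨g.2 * A.1 * g.1, by
        rw [det_mul, det_mul, A.2, mul_one, ← det_mul, g.inv_val, det_one]⟩
      left_inv := fun A => Subtype.ext <| by
        change g.2 * (g.1 * A.1 * g.2) * g.1 = A.1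
        rw [show g.2 * (g.1 * A.1 * g.2) * g.1 = g.2 * g.1 * A.1 * (g.2 * g.1) by
          simp only [mul_assoc], g.inv_val, one_mul, mul_one]
      right_inv := fun A => Subtype.ext <| by
        change g.1 * (g.2 * A.1 * g.1) * g.2 = A.1
        rw [show g.1 * (g.2 * A.1 * g.1) * g.2 = g.1 * g.2 * A.1 * (g.1 * g.2) by
          simp only [mul_assoc], g.val_inv, one_mul, mul_one]
      map_mul' := fun A B => Subtype.ext <| by
        change g.1 * (A.1 * B.1) * g.2 = (g.1 * A.1 * g.2) * (g.1 * B.1 * g.2)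
        rw [show (g.1 * A.1 * g.2) * (g.1 * B.1 * g.2) = g.1 * A.1 * (g.2 * g.1) * B.1 * g.2 by
          simp only [mul_assoc], g.inv_val, mul_one]
        simp only [mul_assoc] }
  map_one' := MulEquiv.ext fun A => Subtype.ext <| by
    change (1 : Matrix (Fin 2) (Fin 2) F) * A.1 * 1 = A.1
    rw [one_mul, mul_one]
  map_mul' g h := MulEquiv.ext fun A => Subtype.ext <| by
    change (g.1 * h.1) * A.1 * (h.2 * g.2) = g.1 * (h.1 * A.1 * h.2) * g.2
    simp only [mul_assoc]

theorem toGL_slConj (g : GL (Fin 2) F) (A : SL(2, F)) :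
    SpecialLinearGroup.toGL (slConj F g A) = g * SpecialLinearGroup.toGL A * g⁻¹ := by
  ext i j; rfl

/-- A cyclic group of even order, with generator `g`, has a homomorphism to `ℤ/2` which maps `g`
to the generator and whose kernel consists of the squares. -/
theorem exists_hom_zmod_two {C : Type} [Group C] {g : C} (hg : ∀ x, x ∈ Subgroup.zpowers g)
    (ho : 2 ∣ orderOf g) : ∃ χ : C →* Multiplicative (ZMod 2), χ g = Multiplicative.ofAdd 1 ∧
      ∀ x, χ x = 1 ↔ x ∈ Subgroup.zpowers (g ^ 2) := by
  have h2 : orderOf (Multiplicative.ofAdd (1 : ZMod 2)) = 2 := by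
    rw [orderOf_ofAdd_eq_addOrderOf, ZMod.addOrderOf_one]
  refine ⟨monoidHomOfForallMemZpowers hg (g' := Multiplicative.ofAdd (1 : ZMod 2)) (by rw [h2]; exact ho),
    monoidHomOfForallMemZpowers_apply_gen _ _, fun x => ?_⟩
  obtain ⟨n, rfl⟩ := hg x
  dsimp only
  rw [map_zpow, monoidHomOfForallMemZpowers_apply_gen, ← orderOf_dvd_iff_zpow_eq_one, h2]
  constructor
  · rintro ⟨k, hk⟩
    exact ⟨k, by dsimp only; rw [hk, _root_.zpow_mul]; norm_cast⟩
  · rintro ⟨k, hk⟩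
    have h3 : g ^ (n - 2 * k) = 1 := by
      dsimp only at hk
      rw [_root_.zpow_sub, ← hk, _root_.zpow_mul]; norm_cast; simp
    rw [← orderOf_dvd_iff_zpow_eq_one] at h3
    have h4 : (2 : ℤ) ∣ n - 2 * k := dvd_trans (by exact_mod_cast ho) h3
    push_cast
    omega

end PGL

/-! ### Obstructions described by powers of one element -/

section TorusCriterion

/-- The first coordinate of `ℤ/2 × ℤ/2`. -/
def fstV4 : Additive V4 →+ ZMod 2 :=
  (AddMonoidHom.fst (ZMod 2) (ZMod 2)).comp (AddEquiv.additiveMultiplicative _).toAddMonoidHom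

/-- The second coordinate of `ℤ/2 × ℤ/2`. -/
def sndV4 : Additive V4 →+ ZMod 2 :=
  (AddMonoidHom.snd (ZMod 2) (ZMod 2)).comp (AddEquiv.additiveMultiplicative _).toAddMonoidHom

/-- The exponents `e` that describe the factor set of the section `(i, j) ↦ Dⁱ Aʲ`: if `D² = T`, `A² = 1`
and `A D = Tʳ D A`, then `(Dⁱ Aʲ) (Dᵏ Aˡ) = Tᵉ Dⁱ⁺ᵏ Aʲ⁺ˡ`, where `i + k` and `j + l` are reduced
modulo two. -/
def factorExponent (r : ℕ) (g h : ZMod 2 × ZMod 2) : ℕ :=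
  g.1.val * h.1.val + h.1.val * g.2.val * r

/-- The exponents `factorExponent` fail to satisfy the cocycle identity, twisted by `n ↦ q n` for
`q = 2 r + 1`, exactly by `2 r (r + 1)` times the value of a cocycle `a² ∪ b`. -/
theorem factorExponent_cocycle (r : ℕ) (g h k : ZMod 2 × ZMod 2) :
    (2 * r + 1) ^ g.2.val * factorExponent r h k + factorExponent r g (h + k) =
      2 * r * (r + 1) * (g.2 * h.2 * k.1).val +
        (factorExponent r g h + factorExponent r (g + h) k) := by
  obtain ⟨m, n⟩ := k
  obtain ⟨k, l⟩ := h
  obtain ⟨i, j⟩ := g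
  have h2 : (1 + 1 : ZMod 2) = 0 := rfl
  have hv : (1 : ZMod 2).val = 1 := rfl
  rcases zmod_two_cases i with rfl | rfl <;> rcases zmod_two_cases j with rfl | rfl <;>
    rcases zmod_two_cases k with rfl | rfl <;> rcases zmod_two_cases l with rfl | rfl <;>
      rcases zmod_two_cases m with rfl | rfl <;>
        simp only [factorExponent, Prod.mk_add_mk, h2, hv, add_zero, zero_add, ZMod.val_zero,
          mul_zero, zero_mul, mul_one, one_mul, pow_zero, pow_one] <;> ring

variable {G E : Type} [Group G] [Finite G] [Group E]

/-- The obstruction is `a² ∪ b` if the extension of `ker f` to a double cover is described by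
lifts `D`, `A` of a basis of `ℤ/2 × ℤ/2` and an element `T` of the cover over `D²`. -/
theorem exhibitsStarB_of_generators {f : G →* V4} {d : E →* G} {z T : E}
    (hd : IsDoubleCover d z) (hr : d.range = f.ker) (hE : SplitsModTwo E)
    (hE' : Odd (Nat.card (Abelianization E))) {D A : G} {r : ℕ}
    (hfD : f D = Multiplicative.ofAdd (1, 0)) (hfA : f A = Multiplicative.ofAdd (0, 1))
    (hD : D * D = d T) (hA : A * A = 1) (hAD : A * D = d (T ^ r) * (D * A))
    (hT : T ^ (2 * r * (r + 1)) = z)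
    (hlD : ∀ l : E →* E, (∀ x, d (l x) = D * d x * D⁻¹) → l T = T)
    (hlA : ∀ l : E →* E, (∀ x, d (l x) = A * d x * A⁻¹) → l T = T ^ (2 * r + 1)) :
    ExhibitsStarB f := by
  have h2 : (1 + 1 : ZMod 2) = 0 := rfl
  have hv : (1 : ZMod 2).val = 1 := rfl
  have hDT : ∀ n, D * d (T ^ n) = d (T ^ n) * D := by
    intro n
    rw [map_pow, ← hD]
    exact ((Commute.refl D).mul_right (Commute.refl D)).pow_right n
  have hDD : ∀ i k : ZMod 2, D ^ i.val * D ^ k.val = d (T ^ (i.val * k.val)) * D ^ (i + k).val := by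
    intro i k
    rcases zmod_two_cases i with rfl | rfl <;> rcases zmod_two_cases k with rfl | rfl <;>
      simp [h2, hv, hD]
  have hAA : ∀ j l : ZMod 2, A ^ j.val * A ^ l.val = A ^ (j + l).val := by
    intro j l
    rcases zmod_two_cases j with rfl | rfl <;> rcases zmod_two_cases l with rfl | rfl <;>
      simp [h2, hv, hA]
  have hAD' : ∀ j k : ZMod 2, A ^ j.val * D ^ k.val =
      d (T ^ (k.val * j.val * r)) * (D ^ k.val * A ^ j.val) := by
    intro j k
    rcases zmod_two_cases j with rfl | rfl <;> rcases zmod_two_cases k with rfl | rfl <;>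
      simp [hv, hAD]
  have hDT' : ∀ (i : ZMod 2) n, D ^ i.val * d (T ^ n) = d (T ^ n) * D ^ i.val := by
    intro i n
    rcases zmod_two_cases i with rfl | rfl
    · simp
    · rw [hv, pow_one, hDT]
  let s : V4 → G := fun g => D ^ g.toAdd.1.val * A ^ g.toAdd.2.val
  have hs : ∀ h, f (s h) = h := by
    intro h
    obtain ⟨⟨i, j⟩, rfl⟩ := Multiplicative.ofAdd.surjective h
    simp only [s, map_mul, map_pow, hfD, hfA, ← ofAdd_nsmul, ← ofAdd_add, toAdd_ofAdd]
    congr 1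
    ext <;> simp
  have ha : sndV4 (Additive.ofMul (Multiplicative.ofAdd ((0, 1) : ZMod 2 × ZMod 2))) = 1 := rfl
  have ha' : sndV4 (Additive.ofMul (Multiplicative.ofAdd ((1, 0) : ZMod 2 × ZMod 2))) = 0 := rfl
  have hb : fstV4 (Additive.ofMul (Multiplicative.ofAdd ((1, 0) : ZMod 2 × ZMod 2))) = 1 := rfl
  refine exhibitsStarB_of_doubleCover hd hr hE hE' (a := sndV4) (b := fstV4) (s := s)
    (F := fun g h => T ^ factorExponent r g.toAdd h.toAdd) ?_ ?_ ?_ hs ?_ ?_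
  · intro h; rw [h] at ha; exact zero_ne_one ha
  · intro h; rw [h] at hb; exact zero_ne_one hb
  · intro h; rw [h, hb] at ha'; exact one_ne_zero ha'
  · intro g h
    change D ^ g.toAdd.1.val * A ^ g.toAdd.2.val * (D ^ h.toAdd.1.val * A ^ h.toAdd.2.val) =
      d (T ^ (g.toAdd.1.val * h.toAdd.1.val + h.toAdd.1.val * g.toAdd.2.val * r)) *
        (D ^ (g.toAdd.1 + h.toAdd.1).val * A ^ (g.toAdd.2 + h.toAdd.2).val)
    generalize g.toAdd.1 = i, g.toAdd.2 = j, h.toAdd.1 = k, h.toAdd.2 = l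
    calc D ^ i.val * A ^ j.val * (D ^ k.val * A ^ l.val)
        = D ^ i.val * (A ^ j.val * D ^ k.val) * A ^ l.val := by simp only [mul_assoc]
      _ = D ^ i.val * d (T ^ (k.val * j.val * r)) * D ^ k.val * (A ^ j.val * A ^ l.val) := by
          rw [hAD']; simp only [mul_assoc]
      _ = d (T ^ (k.val * j.val * r)) * (D ^ i.val * D ^ k.val) * (A ^ j.val * A ^ l.val) := by
          rw [hDT']; simp only [mul_assoc]
      _ = d (T ^ (k.val * j.val * r) * T ^ (i.val * k.val)) *
            (D ^ (i + k).val * A ^ (j + l).val) := by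
          rw [hDD, hAA, map_mul]; simp only [mul_assoc]
      _ = _ := by rw [← pow_add, add_comm]
  · intro L hL g h k
    -- the action of `Dⁱ Aʲ` is the composite of those of `Dⁱ` and `Aʲ`, by uniqueness of lifts
    have hLT : L g T = T ^ ((2 * r + 1) ^ g.toAdd.2.val) := by
      obtain ⟨⟨i, j⟩, rfl⟩ := Multiplicative.ofAdd.surjective g
      have hA1 := hlA (L (.ofAdd (0, 1))) fun x => by
        rw [hL]; simp [s, hv]
      have hD1 := hlD (L (.ofAdd (1, 0))) fun x => by
        rw [hL]; simp [s, hv]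
      rcases zmod_two_cases i with rfl | rfl <;> rcases zmod_two_cases j with rfl | rfl
      · have : L (.ofAdd (0, 0)) = MonoidHom.id E := hd.lift_unique hE' fun x => by
          rw [hL]; simp [s]
        rw [this]; simp
      · rw [hA1]; simp [hv]
      · rw [hD1]; simp
      · have : L (.ofAdd (1, 1)) = (L (.ofAdd (1, 0))).comp (L (.ofAdd (0, 1))) :=
          hd.lift_unique hE' fun x => by
            rw [MonoidHom.comp_apply, hL, hL, hL]; simp [s, hv, mul_assoc]
        rw [this, MonoidHom.comp_apply, hA1, map_pow, hD1]; simp [hv]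
    rw [map_pow, hLT, ← hT, ← pow_mul, ← pow_mul, ← pow_add, ← pow_add, ← pow_add]
    exact congrArg (T ^ ·) (factorExponent_cocycle r g.toAdd h.toAdd k.toAdd)

end TorusCriterion

/-! ### The homomorphism from `PGL(2, F) ⋊ ⟨β⟩` to `ℤ/2 × ℤ/2` -/

section Diagonal

variable {F : Type} [Field F]

/-- The matrix `diag(t, 1)` in `GL(2, F)`. -/
def diagGL (t : Fˣ) : GL (Fin 2) F where
  val := !![(t : F), 0; 0, 1]
  inv := !![((t⁻¹ : Fˣ) : F), 0; 0, 1]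
  val_inv := by simp [one_fin_two]
  inv_val := by simp [one_fin_two]

theorem coe_diagGL (t : Fˣ) : (diagGL t : Matrix (Fin 2) (Fin 2) F) = !![(t : F), 0; 0, 1] := rfl

theorem coe_diagGL_inv (t : Fˣ) :
    (((diagGL t)⁻¹ : GL (Fin 2) F) : Matrix (Fin 2) (Fin 2) F) = !![((t⁻¹ : Fˣ) : F), 0; 0, 1] :=
  rfl

theorem diagGL_mul (s t : Fˣ) : diagGL (s * t) = diagGL s * diagGL t := by
  apply Units.ext
  simp [coe_diagGL]

theorem det_diagGL (t : Fˣ) : GeneralLinearGroup.det (diagGL t) = t := by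
  apply Units.ext
  simp [coe_diagGL, GeneralLinearGroup.val_det_apply, det_fin_two]

theorem glAut_diagGL (σ : F ≃+* F) (t : Fˣ) :
    glAut F σ (diagGL t) = diagGL (Units.mapEquiv σ.toMulEquiv t) := by
  apply Units.ext
  ext i j
  change σ (diagGL t i j) = _
  fin_cases i <;> fin_cases j <;> simp [coe_diagGL]

theorem slAut_torus (σ : F ≃+* F) (t : Fˣ) :
    slAut F σ (torus t) = torus (Units.mapEquiv σ.toMulEquiv t) := by
  ext i j
  rw [slAut_apply]
  fin_cases i <;> fin_cases j <;> simp [coe_torus]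

theorem slConj_diagGL_torus (s t : Fˣ) : slConj F (diagGL s) (torus t) = torus t := by
  apply Subtype.ext
  change (diagGL s).1 * (torus t).1 * ((diagGL s)⁻¹ : GL (Fin 2) F).1 = _
  rw [coe_diagGL, coe_diagGL_inv, coe_torus]
  ext i j
  fin_cases i <;> fin_cases j <;> simp
  field_simp

/-- In `PGL(2, F)`, the matrices `diag(t², 1)` and `diag(t, t⁻¹)` agree. -/
theorem mk_diagGL_mul_self (t : Fˣ) : ProjGenLinGroup.mk (diagGL (t * t)) =
    SpecialLinearGroup.toPGL (torus t) := by
  change _ = ProjGenLinGroup.mk (SpecialLinearGroup.toGL (torus t))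
  symm
  rw [ProjGenLinGroup.mk_eq_mk_iff]
  refine ⟨t, Units.ext ?_⟩
  change (torus t : Matrix (Fin 2) (Fin 2) F) * Matrix.scalar (Fin 2) t.1 = _
  rw [coe_torus, coe_diagGL]
  ext i j
  fin_cases i <;> fin_cases j <;> simp

/-- A matrix whose determinant is a square belongs to `SL(2, F)` up to scalars. -/
theorem mk_mem_range_toPGL_iff (g : GL (Fin 2) F) :
    ProjGenLinGroup.mk g ∈ (SpecialLinearGroup.toPGL : SL(2, F) →* PGL(2, F)).range ↔
      ∃ c : Fˣ, GeneralLinearGroup.det g = c * c := by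
  constructor
  · rintro ⟨M, hM⟩
    obtain ⟨u, hu⟩ := ProjGenLinGroup.mk_eq_mk_iff.1
      (show ProjGenLinGroup.mk (SpecialLinearGroup.toGL M) = ProjGenLinGroup.mk g from hM)
    refine ⟨u, ?_⟩
    rw [← hu, map_mul, GeneralLinearGroup.det_scalar, Fintype.card_fin, pow_two]
    have : GeneralLinearGroup.det (SpecialLinearGroup.toGL M) = 1 := Units.ext M.2
    rw [this, one_mul]
  · rintro ⟨c, hc⟩
    have hdet : GeneralLinearGroup.det (g * GeneralLinearGroup.scalar (Fin 2) c⁻¹) = 1 := by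
      rw [map_mul, GeneralLinearGroup.det_scalar, Fintype.card_fin, hc, inv_pow, pow_two,
        mul_inv_cancel]
    refine ⟨⟨(g * GeneralLinearGroup.scalar (Fin 2) c⁻¹).1, congrArg Units.val hdet⟩, ?_⟩
    change ProjGenLinGroup.mk _ = _
    symm
    rw [ProjGenLinGroup.mk_eq_mk_iff]
    exact ⟨c⁻¹, Units.ext rfl⟩

end Diagonal

section HomToV4

variable {F : Type} [Field F]

theorem mem_zpowers_sq_iff {C : Type} [CommGroup C] {g : C} (hg : ∀ x, x ∈ Subgroup.zpowers g)
    (x : C) : x ∈ Subgroup.zpowers (g ^ 2) ↔ ∃ c, x = c * c := by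
  constructor
  · rintro ⟨n, rfl⟩
    refine ⟨g ^ n, ?_⟩
    dsimp only
    rw [pow_two, _root_.mul_zpow]
  · rintro ⟨c, rfl⟩
    obtain ⟨n, rfl⟩ := hg c
    refine ⟨n, ?_⟩
    dsimp only
    rw [pow_two, _root_.mul_zpow]

/-- The homomorphism `PGL(2, F) ⋊ ⟨β⟩ → ℤ/2 × ℤ/2` given by the class of the determinant modulo
squares and the parity of the exponent of `β`. -/
theorem exists_hom_V4 {ν : Fˣ} (hν : ∀ t, t ∈ Subgroup.zpowers ν) (hν2 : 2 ∣ orderOf ν)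
    {β : F ≃+* F} (hβ : 2 ∣ orderOf β) : ∃ f : PGLSemidirect F β →* V4,
      f (SemidirectProduct.inl (ProjGenLinGroup.mk (diagGL ν))) = Multiplicative.ofAdd (1, 0) ∧
      f (SemidirectProduct.inr ⟨β, Subgroup.mem_zpowers β⟩) = Multiplicative.ofAdd (0, 1) ∧
      ∀ x, x ∈ f.ker ↔
        x.left ∈ (SpecialLinearGroup.toPGL : SL(2, F) →* PGL(2, F)).range ∧
          x.right.1 ∈ Subgroup.zpowers (β ^ 2) := by
  obtain ⟨χ, hχν, hχ⟩ := exists_hom_zmod_two hν hν2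
  have hβgen : ∀ x, x ∈ Subgroup.zpowers (⟨β, Subgroup.mem_zpowers β⟩ : Subgroup.zpowers β) := by
    rintro ⟨_, n, rfl⟩
    exact ⟨n, Subtype.ext rfl⟩
  obtain ⟨ξ, hξβ, hξ⟩ := exists_hom_zmod_two hβgen (by rwa [← Subgroup.orderOf_coe])
  have hχ' : ∀ t, χ t = 1 ↔ ∃ c, t = c * c := fun t => (hχ t).trans (mem_zpowers_sq_iff hν t)
  -- a homomorphism to `ℤ/2` is determined by its kernel
  have hχσ : ∀ (σ : F ≃+* F) (t : Fˣ), χ (Units.mapEquiv σ.toMulEquiv t) = χ t := by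
    intro σ t
    have h1 : χ (Units.mapEquiv σ.toMulEquiv t) = 1 ↔ χ t = 1 := by
      rw [hχ', hχ']
      constructor
      · rintro ⟨c, hc⟩
        refine ⟨(Units.mapEquiv σ.toMulEquiv).symm c, (Units.mapEquiv σ.toMulEquiv).injective ?_⟩
        rw [hc, map_mul, MulEquiv.apply_symm_apply]
      · rintro ⟨c, rfl⟩
        exact ⟨_, map_mul _ _ _⟩
    generalize χ (Units.mapEquiv σ.toMulEquiv t) = x at h1
    generalize χ t = y at h1
    revert x y
    decide
  let i₁ : Multiplicative (ZMod 2) →* V4 := AddMonoidHom.toMultiplicative (AddMonoidHom.inl _ _)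
  let i₂ : Multiplicative (ZMod 2) →* V4 := AddMonoidHom.toMultiplicative (AddMonoidHom.inr _ _)
  let f₁ : PGL(2, F) →* V4 := i₁.comp <| ProjGenLinGroup.lift (χ.comp GeneralLinearGroup.det) <| by
    ext t
    rw [MonoidHom.comp_apply, MonoidHom.comp_apply, GeneralLinearGroup.det_scalar,
      Fintype.card_fin, (hχ' _).2 ⟨t, pow_two t⟩]
    rfl
  have hf₁ : ∀ g, f₁ (ProjGenLinGroup.mk g) = i₁ (χ (GeneralLinearGroup.det g)) := fun g => rfl
  let f : PGLSemidirect F β →* V4 := SemidirectProduct.lift f₁ (i₂.comp ξ) <| by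
    intro γ
    refine MonoidHom.ext fun x => ?_
    induction x using ProjGenLinGroup.induction_on with
    | mk g =>
      change f₁ (pglAut F γ.1 (ProjGenLinGroup.mk g)) = _ * f₁ (ProjGenLinGroup.mk g) * _⁻¹
      rw [mul_inv_cancel_comm, pglAut_mk, hf₁, hf₁, det_glAut, hχσ]
  refine ⟨f, ?_, ?_, fun x => ?_⟩
  · rw [SemidirectProduct.lift_inl, hf₁, det_diagGL, hχν]; rfl
  · rw [SemidirectProduct.lift_inr, MonoidHom.comp_apply, hξβ]; rfl
  · obtain ⟨g, hg⟩ := ProjGenLinGroup.mk_surjective x.left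
    have hx : f x = i₁ (χ (GeneralLinearGroup.det g)) * i₂ (ξ x.right) := by
      rw [← hf₁, hg]; rfl
    have hi : ∀ u v, i₁ u * i₂ v = 1 ↔ u = 1 ∧ v = 1 := by decide
    rw [MonoidHom.mem_ker, hx, hi, ← hg, mk_mem_range_toPGL_iff, hχ', hξ]
    refine and_congr_right fun _ => ⟨?_, ?_⟩
    · rintro ⟨n, hn⟩
      exact ⟨n, congrArg Subtype.val hn⟩
    · rintro ⟨n, hn⟩
      exact ⟨n, Subtype.ext hn⟩

end HomToV4

/-! ### The property `(∗)_b` for `PGL(2, F) ⋊ ⟨β⟩` -/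

section DoubleCover

variable {F : Type} [Field F]

theorem toPGL_eq_one_iff (M : SL(2, F)) :
    SpecialLinearGroup.toPGL M = 1 ↔ M = 1 ∨ M = torus (-1) := by
  rw [← mem_center_SL2_iff, ← SpecialLinearGroup.toPGL_ker, MonoidHom.mem_ker]

theorem pglAut_toPGL (σ : F ≃+* F) (M : SL(2, F)) :
    pglAut F σ (SpecialLinearGroup.toPGL M) = SpecialLinearGroup.toPGL (slAut F σ M) := by
  change pglAut F σ (ProjGenLinGroup.mk _) = ProjGenLinGroup.mk _
  rw [pglAut_mk, glAut_toGL]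

/-- The semidirect product `SL(2, F) ⋊ ⟨β⟩` for an automorphism `β` of the field `F`. -/
abbrev SLSemidirect (F : Type) [Field F] (β : F ≃+* F) : Type :=
  SL(2, F) ⋊[(slAut F).comp (Subgroup.zpowers β).subtype] (Subgroup.zpowers β)

/-- The homomorphism `SL(2, F) ⋊ ⟨β²⟩ → PGL(2, F) ⋊ ⟨β⟩`. -/
def coverMap (F : Type) [Field F] (β : F ≃+* F) : SLSemidirect F (β ^ 2) →* PGLSemidirect F β :=
  SemidirectProduct.map SpecialLinearGroup.toPGL
    (Subgroup.inclusion (Subgroup.zpowers_le.2 ⟨2, zpow_ofNat β 2⟩)) fun γ =>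
      MonoidHom.ext fun M => (pglAut_toPGL γ.1 M).symm

variable {β : F ≃+* F}

theorem coverMap_inl (M : SL(2, F)) : coverMap F β (SemidirectProduct.inl M) =
    SemidirectProduct.inl (SpecialLinearGroup.toPGL M) := SemidirectProduct.ext rfl rfl

theorem isDoubleCover_coverMap (h2 : (2 : F) ≠ 0) :
    IsDoubleCover (coverMap F β) (SemidirectProduct.inl (torus (-1))) where
  ne_one h := torus_neg_one_ne_one h2 (SemidirectProduct.inl_injective h)
  ker_iff x := by
    constructor
    · intro h
      have h1 : SpecialLinearGroup.toPGL x.left = 1 := congrArg SemidirectProduct.left h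
      have h3 : x.right = 1 :=
        Subgroup.inclusion_injective _ (congrArg SemidirectProduct.right h)
      refine ((toPGL_eq_one_iff _).1 h1).imp (fun h => ?_) fun h => ?_
      · exact SemidirectProduct.ext h h3
      · exact SemidirectProduct.ext h h3
    · rintro (rfl | rfl)
      · exact map_one _
      · rw [coverMap_inl, (toPGL_eq_one_iff _).2 (Or.inr rfl), map_one]

theorem mem_range_coverMap_iff (x : PGLSemidirect F β) : x ∈ (coverMap F β).range ↔
    x.left ∈ (SpecialLinearGroup.toPGL : SL(2, F) →* PGL(2, F)).range ∧
      x.right.1 ∈ Subgroup.zpowers (β ^ 2) := by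
  constructor
  · rintro ⟨y, rfl⟩
    exact ⟨⟨y.left, rfl⟩, y.right.2⟩
  · rintro ⟨⟨M, hM⟩, h⟩
    exact ⟨⟨M, ⟨x.right.1, h⟩⟩, SemidirectProduct.ext hM (Subtype.ext rfl)⟩

/-- Endomorphisms of `SL(2, F) ⋊ ⟨β²⟩` agree on `SL(2, F)` if they do so modulo the centre. -/
theorem eq_inl_of_coverMap_eq [Finite F] (hF : 4 < Nat.card F) (h2 : (2 : F) ≠ 0)
    (l : SLSemidirect F (β ^ 2) →* SLSemidirect F (β ^ 2)) (θ : MulAut SL(2, F))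
    (h : ∀ M, coverMap F β (l (SemidirectProduct.inl M)) =
      SemidirectProduct.inl (SpecialLinearGroup.toPGL (θ M))) (M : SL(2, F)) :
    l (SemidirectProduct.inl M) = SemidirectProduct.inl (θ M) := by
  have := (isDoubleCover_coverMap (β := β) h2).lift_unique (odd_card_abelianization_SL2 hF)
    (l := l.comp SemidirectProduct.inl) (l' := SemidirectProduct.inl.comp θ.toMonoidHom)
    fun M => by
      rw [MonoidHom.comp_apply, h]; exact (coverMap_inl _).symm
  exact DFunLike.congr_fun this M

end DoubleCover

section Exhibits

variable {F : Type} [Field F] [Finite F]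

theorem finite_PGLSemidirect (β : F ≃+* F) : Finite (PGLSemidirect F β) := by
  have h1 : Finite (F ≃+* F) := DFunLike.finite _
  have h2 : Finite PGL(2, F) := Finite.of_surjective _ ProjGenLinGroup.mk_surjective
  exact Finite.of_equiv _ SemidirectProduct.equivProd.symm

/-- A group isomorphic to `PGL(2, F) ⋊ ⟨β⟩`, where `|F| = q²` and an odd power of `β` is
`x ↦ x ^ q`, has the property `(∗)_b`. The kernel corresponds to the image of
`SL(2, F) ⋊ ⟨β²⟩`. -/
theorem exists_exhibitsStarB {β : F ≃+* F} {r k : ℕ} (hr : 0 < r)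
    (hF : Nat.card F = (2 * r + 1) ^ 2) (hk : Odd k) (hβ : ∀ x, (β ^ k) x = x ^ (2 * r + 1))
    {G : Type} [Group G] (ψ : G ≃* PGLSemidirect F β) :
    ∃ f : G →* V4, ExhibitsStarB f ∧ ∀ x, x ∈ f.ker ↔ ψ x ∈ (coverMap F β).range := by
  have hF4 : 4 < Nat.card F := by rw [hF]; nlinarith
  have hcard : Nat.card F = 2 * (2 * r * (r + 1)) + 1 := by rw [hF]; ring
  have hF1 : Nat.card F % 4 = 1 := by
    rw [show Nat.card F = 4 * (r * (r + 1)) + 1 by rw [hF]; ring]; omega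
  have h2 := two_ne_zero_of_odd_card hF1
  have hfin := finite_PGLSemidirect β
  have hG : Finite G := Finite.of_equiv _ ψ.symm.toEquiv
  have hAut : Finite (F ≃+* F) := DFunLike.finite _
  obtain ⟨ν, hν⟩ := IsCyclic.exists_generator (α := Fˣ)
  have hoν : orderOf ν = 2 * (2 * r * (r + 1)) := by
    rw [orderOf_eq_card_of_forall_mem_zpowers hν, Nat.card_units, hcard]; rfl
  -- `β ^ k` is an involution
  have hβ2 : β ^ k * β ^ k = 1 := by
    ext x
    change (β ^ k) ((β ^ k) x) = x
    rw [hβ, hβ, ← pow_mul, ← pow_two, ← hF]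
    have := Fintype.ofFinite F
    rw [Nat.card_eq_fintype_card, FiniteField.pow_card]
  -- `β ^ k` moves the generator `ν`, whose order exceeds `2 r = q - 1`
  have hβ1 : β ^ k ≠ 1 := by
    intro h
    have h3 : ν ^ (2 * r) = 1 := by
      have h4 : (ν : F) ^ (2 * r + 1) = ν := by rw [← hβ, h]; rfl
      refine mul_right_cancel (b := ν) ?_
      rw [← pow_succ, one_mul]
      exact Units.ext h4
    have := Nat.le_of_dvd (by omega) (orderOf_dvd_of_pow_eq_one h3)
    rw [hoν] at this
    nlinarith
  have hoβ : 2 ∣ orderOf β := by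
    by_contra h
    have hc : Nat.Coprime (orderOf β) 2 := by
      rw [Nat.coprime_comm, Nat.prime_two.coprime_iff_not_dvd]; exact h
    refine hβ1 (orderOf_dvd_iff_pow_eq_one.1 (hc.dvd_of_dvd_mul_left
      (orderOf_dvd_of_pow_eq_one ?_)))
    rw [mul_comm, _root_.pow_mul, pow_two, hβ2]
  have hΓ : Odd (Nat.card (Subgroup.zpowers (β ^ 2))) := by
    rw [Nat.card_zpowers]
    refine Odd.of_dvd_nat hk (orderOf_dvd_of_pow_eq_one ?_)
    rw [← _root_.pow_mul, mul_comm, _root_.pow_mul, pow_two, hβ2]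
  obtain ⟨f₀, hf₀D, hf₀β, hker⟩ := exists_hom_V4 hν (by rw [hoν]; exact dvd_mul_right _ _) hoβ
  have hβmem : β ^ k ∈ Subgroup.zpowers β := ⟨k, zpow_natCast β k⟩
  let D : PGLSemidirect F β := SemidirectProduct.inl (ProjGenLinGroup.mk (diagGL ν))
  let A : PGLSemidirect F β := SemidirectProduct.inr ⟨β ^ k, hβmem⟩
  let T : SLSemidirect F (β ^ 2) := SemidirectProduct.inl (torus ν)
  have hβν : Units.mapEquiv (β ^ k).toMulEquiv ν = ν ^ (2 * r + 1) := Units.ext (hβ ν)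
  have hA : A * A = 1 := by
    rw [← map_mul, ← map_one SemidirectProduct.inr]
    exact congrArg _ (Subtype.ext hβ2)
  have hD : D * D = coverMap F β T := by
    rw [coverMap_inl, ← mk_diagGL_mul_self, diagGL_mul, map_mul, map_mul]
  have hAx : ∀ x : PGL(2, F), A * SemidirectProduct.inl x =
      SemidirectProduct.inl (pglAut F (β ^ k) x) * A := by
    intro x
    rw [← mul_inv_eq_iff_eq_mul, ← map_inv]
    exact (SemidirectProduct.inl_aut _ _).symm
  have hAD : A * D = coverMap F β (T ^ r) * (D * A) := by
    rw [hAx, pglAut_mk, glAut_diagGL, hβν, ← mul_assoc]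
    congr 1
    rw [← map_pow, ← map_pow, coverMap_inl, ← mk_diagGL_mul_self, ← map_mul, ← map_mul,
      ← diagGL_mul]
    congr 3
    rw [pow_succ, two_mul, pow_add]
  -- `T` has order `|F| - 1 = 4 r (r + 1)`
  have hT : T ^ (2 * r * (r + 1)) = SemidirectProduct.inl (torus (-1)) := by
    rw [← map_pow, ← map_pow, pow_half_eq_neg_one hν hcard]
  have hlD : ∀ l : SLSemidirect F (β ^ 2) →* SLSemidirect F (β ^ 2),
      (∀ x, coverMap F β (l x) = D * coverMap F β x * D⁻¹) → l T = T := by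
    intro l hl
    rw [eq_inl_of_coverMap_eq hF4 h2 l (slConj F (diagGL ν)), slConj_diagGL_torus]
    intro M
    rw [hl, coverMap_inl, ← map_inv, ← map_mul, ← map_mul]
    congr 1
    change _ = ProjGenLinGroup.mk (SpecialLinearGroup.toGL _)
    rw [toGL_slConj, map_mul, map_mul, map_inv]
    rfl
  have hlA : ∀ l : SLSemidirect F (β ^ 2) →* SLSemidirect F (β ^ 2),
      (∀ x, coverMap F β (l x) = A * coverMap F β x * A⁻¹) → l T = T ^ (2 * r + 1) := by
    intro l hl
    rw [eq_inl_of_coverMap_eq hF4 h2 l (slAut F (β ^ k)), slAut_torus, hβν, map_pow, map_pow]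
    intro M
    rw [hl, coverMap_inl, hAx, mul_inv_cancel_right, pglAut_toPGL]
  have hfA : f₀ A = Multiplicative.ofAdd (0, 1) := by
    have : A = SemidirectProduct.inr ⟨β, Subgroup.mem_zpowers β⟩ ^ k := by
      rw [← map_pow]; rfl
    obtain ⟨n, rfl⟩ := hk
    rw [this, map_pow, hf₀β, pow_succ, _root_.pow_mul,
      show (Multiplicative.ofAdd (0, 1) : V4) ^ 2 = 1 from rfl, one_pow, one_mul]
  let d : SLSemidirect F (β ^ 2) →* G := ψ.symm.toMonoidHom.comp (coverMap F β)
  have hdψ : ∀ x, d x = ψ.symm (coverMap F β x) := fun _ => rfl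
  have hψd : ∀ x, ψ (d x) = coverMap F β x := fun _ => ψ.apply_symm_apply _
  let f : G →* V4 := f₀.comp ψ.toMonoidHom
  have hf : ∀ x, x ∈ f.ker ↔ ψ x ∈ (coverMap F β).range := by
    intro x
    rw [mem_range_coverMap_iff, ← hker]
    rfl
  have hfψ : ∀ x, f (ψ.symm x) = f₀ x := fun x => congrArg f₀ (ψ.apply_symm_apply x)
  have hd : IsDoubleCover d (SemidirectProduct.inl (torus (-1))) :=
    ⟨(isDoubleCover_coverMap h2).ne_one, fun x => by
      rw [hdψ, EmbeddingLike.map_eq_one_iff, (isDoubleCover_coverMap h2).ker_iff]⟩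
  refine ⟨f, exhibitsStarB_of_generators hd ?_ (splitsModTwo_semidirect _ hF1 hF4 hΓ)
    (odd_card_abelianization_semidirect _ hF4 hΓ) (D := ψ.symm D) (A := ψ.symm A) (T := T) (r := r)
    ?_ ?_ ?_ ?_ ?_ hT ?_ ?_, hf⟩
  · ext x
    rw [hf]
    constructor
    · rintro ⟨y, rfl⟩
      exact ⟨y, (hψd y).symm⟩
    · rintro ⟨y, hy⟩
      exact ⟨y, by rw [hdψ, hy, ψ.symm_apply_apply]⟩
  · rw [hfψ, hf₀D]
  · rw [hfψ, hfA]
  · rw [← map_mul, hD, hdψ]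
  · rw [← map_mul, hA, map_one]
  · rw [← map_mul, hAD, map_mul, map_mul, hdψ]
  · intro l hl
    refine hlD l fun x => ψ.symm.injective ?_
    rw [← hdψ, hl, hdψ, map_mul, map_mul, map_inv]
  · intro l hl
    refine hlA l fun x => ψ.symm.injective ?_
    rw [← hdψ, hl, hdψ, map_mul, map_mul, map_inv]

end Exhibits

/-! ### Automorphisms of `SL(2, F)` -/

section Unipotent

variable {F : Type} [Field F]

theorem upper_mul (x y : F) : upper x * upper y = upper (x + y) := by
  ext i j
  fin_cases i <;> fin_cases j <;> simp [coe_upper, add_comm]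

theorem lower_mul (x y : F) : lower x * lower y = lower (x + y) := by
  ext i j
  fin_cases i <;> fin_cases j <;> simp [coe_lower]

theorem upper_injective : Function.Injective (upper : F → SL(2, F)) := by
  intro x y h
  simpa [coe_upper] using congrArg (fun A : SL(2, F) => A 0 1) h

theorem lower_injective : Function.Injective (lower : F → SL(2, F)) := by
  intro x y h
  simpa [coe_lower] using congrArg (fun A : SL(2, F) => A 1 0) h

theorem upper_zero : (upper 0 : SL(2, F)) = 1 := by
  ext i j
  fin_cases i <;> fin_cases j <;> simp [coe_upper]

theorem lower_zero : (lower 0 : SL(2, F)) = 1 := by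
  ext i j
  fin_cases i <;> fin_cases j <;> simp [coe_lower]

theorem upper_pow (x : F) (n : ℕ) : upper x ^ n = upper (n * x) := by
  induction n with
  | zero => simp [upper_zero]
  | succ n ih => rw [pow_succ, ih, upper_mul]; congr 1; push_cast; ring

theorem lower_pow (x : F) (n : ℕ) : lower x ^ n = lower (n * x) := by
  induction n with
  | zero => simp [lower_zero]
  | succ n ih => rw [pow_succ, ih, lower_mul]; congr 1; push_cast; ring

theorem slAut_upper (σ : F ≃+* F) (x : F) : slAut F σ (upper x) = upper (σ x) := by
  ext i j
  rw [slAut_apply]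
  fin_cases i <;> fin_cases j <;> simp [coe_upper]

theorem slAut_lower (σ : F ≃+* F) (x : F) : slAut F σ (lower x) = lower (σ x) := by
  ext i j
  rw [slAut_apply]
  fin_cases i <;> fin_cases j <;> simp [coe_lower]

/-- The group `SL(2, F)` is generated by the matrices `upper x` and `lower x`. -/
theorem monoidHom_SL2_ext {G : Type} [Group G] {l l' : SL(2, F) →* G}
    (hu : ∀ x, l (upper x) = l' (upper x)) (hl : ∀ x, l (lower x) = l' (lower x)) : l = l' := by
  refine MonoidHom.ext fun A => SL2.transvection_induction (fun A => l A = l' A) ?_ ?_ A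
  · intro i j h c
    fin_cases i <;> fin_cases j
    · exact absurd rfl h
    · rw [show SpecialLinearGroup.transvection _ c = upper c from ?_]
      · exact hu c
      · ext i j
        fin_cases i <;> fin_cases j <;>
          simp [coe_upper, SpecialLinearGroup.transvection, Matrix.transvection, Matrix.single]
    · rw [show SpecialLinearGroup.transvection _ c = lower c from ?_]
      · exact hl c
      · ext i j
        fin_cases i <;> fin_cases j <;>
          simp [coe_lower, SpecialLinearGroup.transvection, Matrix.transvection, Matrix.single]
    · exact absurd rfl h
  · intro A B hA hB
    rw [map_mul, map_mul, hA, hB]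

theorem slConj_eq_of_mul_eq {g : GL (Fin 2) F} {A M : SL(2, F)}
    (h : (g : Matrix (Fin 2) (Fin 2) F) * M = A * g) : slConj F g M = A := by
  apply Subtype.ext
  change (g : Matrix (Fin 2) (Fin 2) F) * M * (g⁻¹ : GL (Fin 2) F).1 = A
  rw [h, mul_assoc, ← Units.val_mul, mul_inv_cancel, Units.val_one, mul_one]

theorem torus_eq (c : Fˣ) :
    torus c * weyl = upper (c : F) * lower (-(c : F)⁻¹) * upper (c : F) := by
  ext i j
  fin_cases i <;> fin_cases j <;> simp [coe_torus, coe_weyl, coe_upper, coe_lower]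

theorem weyl_eq : (weyl : SL(2, F)) = upper 1 * lower (-1) * upper 1 := by
  have := torus_eq (1 : Fˣ)
  rwa [map_one, one_mul, Units.val_one, inv_one] at this

/-- The product `upper a * lower (-b) * upper a` conjugates `upper a` to `lower (-b)` if and only
if `a b = 1`. -/
theorem upper_lower_relation {a b : F} (hb : b ≠ 0) :
    upper a * lower (-b) * upper a * upper a = lower (-b) * (upper a * lower (-b) * upper a) ↔
      a * b = 1 := by
  constructor
  · intro h
    have h' := congrArg (fun M : SL(2, F) => M 1 0) h
    have h1 : -b = -(b * (1 - a * b)) - b := by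
      simpa [coe_upper, coe_lower, mul_apply, Fin.sum_univ_two, sub_eq_add_neg] using h'
    have h2 : b * (1 - a * b) = 0 := by linear_combination h1
    linear_combination -(mul_eq_zero.1 h2).resolve_left hb
  · intro h
    ext i j
    fin_cases i <;> fin_cases j <;>
      simp [coe_upper, coe_lower, mul_apply, Fin.sum_univ_two] <;> grind

variable {p : ℕ} [Fact p.Prime] [CharP F p]

/-- An element of `SL(2, F)` with `A ^ p = 1` is of the form `1 + a v (-v₁, v₀)` for some vector
`v`. -/
theorem exists_unipotent_form {A : SL(2, F)} (hA : A ^ p = 1) : ∃ a v₀ v₁ : F,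
    A 0 0 = 1 - a * v₀ * v₁ ∧ A 0 1 = a * v₀ ^ 2 ∧ A 1 0 = - (a * v₁ ^ 2) ∧
      A 1 1 = 1 + a * v₀ * v₁ := by
  have h1 : (A : Matrix (Fin 2) (Fin 2) F) ^ p = 1 := congrArg Subtype.val hA
  have h2 : ((A : Matrix (Fin 2) (Fin 2) F) - 1) ^ p = 0 := by
    rw [sub_pow_char_of_commute p (Commute.one_right _), h1, one_pow, sub_self]
  have h3 : ((A : Matrix (Fin 2) (Fin 2) F) - 1).det = 0 := by
    have := congrArg Matrix.det h2
    rw [det_pow, det_zero] at this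
    exact pow_eq_zero_iff (Fact.out : p.Prime).ne_zero |>.1 this
  have hdet : A 0 0 * A 1 1 - A 0 1 * A 1 0 = 1 := by
    rw [← det_fin_two]; exact A.2
  have h4 : (A 0 0 - 1) * (A 1 1 - 1) - A 0 1 * A 1 0 = 0 := by
    rw [det_fin_two] at h3; simpa using h3
  -- `A - 1` is nilpotent, so `A` has trace two
  have htr : A 1 1 = 2 - A 0 0 := by linear_combination hdet - h4
  rw [htr] at hdet ⊢
  by_cases h01 : A 0 1 = 0
  · rw [h01] at hdet ⊢
    have h00 : A 0 0 = 1 := by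
      have : (A 0 0 - 1) ^ 2 = 0 := by linear_combination -hdet
      exact sub_eq_zero.1 (pow_eq_zero_iff two_ne_zero |>.1 this)
    refine ⟨-A 1 0, 0, 1, ?_, ?_, ?_, ?_⟩
    · rw [h00]; ring
    · ring
    · ring
    · rw [h00]; ring
  · refine ⟨(A 0 1)⁻¹, A 0 1, 1 - A 0 0, ?_, ?_, ?_, ?_⟩
    · field_simp; ring
    · field_simp
    · field_simp; linear_combination -hdet
    · field_simp; ring

/-- Two elements of order `p` which do not commute can be conjugated simultaneously to the two
standard unipotent subgroups: the columns of the matrix `g` are vectors fixed by `A` and `B`. -/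
theorem exists_conj_upper_lower {A B : SL(2, F)} (hA : A ^ p = 1) (hB : B ^ p = 1)
    (hAB : A * B ≠ B * A) : ∃ (g : GL (Fin 2) F) (s t : F),
      slConj F g (upper s) = A ∧ slConj F g (lower t) = B := by
  obtain ⟨a, v₀, v₁, hA00, hA01, hA10, hA11⟩ := exists_unipotent_form hA
  obtain ⟨b, w₀, w₁, hB00, hB01, hB10, hB11⟩ := exists_unipotent_form hB
  have hA' : (A : Matrix (Fin 2) (Fin 2) F) =
      !![1 - a * v₀ * v₁, a * v₀ ^ 2; - (a * v₁ ^ 2), 1 + a * v₀ * v₁] := by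
    rw [eta_fin_two A.1, ← hA00, ← hA01, ← hA10, ← hA11]
  have hB' : (B : Matrix (Fin 2) (Fin 2) F) =
      !![1 - b * w₀ * w₁, b * w₀ ^ 2; - (b * w₁ ^ 2), 1 + b * w₀ * w₁] := by
    rw [eta_fin_two B.1, ← hB00, ← hB01, ← hB10, ← hB11]
  have hD : v₀ * w₁ - w₀ * v₁ ≠ 0 := by
    intro hD
    apply hAB
    apply Subtype.ext
    change A.1 * B.1 = B.1 * A.1
    rw [hA', hB', mul_fin_two, mul_fin_two]
    congr 1
    simp only [vecCons_inj, and_true]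
    have hD' : v₀ * w₁ = w₀ * v₁ := sub_eq_zero.1 hD
    refine ⟨⟨?_, ?_⟩, ?_, ?_⟩
    · linear_combination (-(a * b) * (v₀ * w₁ + w₀ * v₁)) * hD'
    · linear_combination (2 * a * b * v₀ * w₀) * hD'
    · linear_combination (-(2 * a * b * v₁ * w₁)) * hD'
    · linear_combination (a * b * (v₀ * w₁ + w₀ * v₁)) * hD'
  let g : GL (Fin 2) F := GeneralLinearGroup.mkOfDetNeZero !![v₀, w₀; v₁, w₁] (by
    rw [det_fin_two_of]; exact hD)
  refine ⟨g, a * (v₀ * w₁ - w₀ * v₁), -b * (v₀ * w₁ - w₀ * v₁), slConj_eq_of_mul_eq ?_,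
    slConj_eq_of_mul_eq ?_⟩
  · change !![v₀, w₀; v₁, w₁] * (upper _ : SL(2, F)).1 = A.1 * !![v₀, w₀; v₁, w₁]
    rw [hA', coe_upper, mul_fin_two, mul_fin_two]
    congr 1
    simp only [vecCons_inj, and_true]
    refine ⟨⟨?_, ?_⟩, ?_, ?_⟩ <;> ring
  · change !![v₀, w₀; v₁, w₁] * (lower _ : SL(2, F)).1 = B.1 * !![v₀, w₀; v₁, w₁]
    rw [hB', coe_lower, mul_fin_two, mul_fin_two]
    congr 1
    simp only [vecCons_inj, and_true]
    refine ⟨⟨?_, ?_⟩, ?_, ?_⟩ <;> ring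

/-- An element of order `p` which commutes with `upper 1` is of the form `upper x`. -/
theorem eq_upper_of_commute {A : SL(2, F)} (hA : A ^ p = 1)
    (h : A * upper 1 = upper 1 * A) : ∃ x, A = upper x := by
  obtain ⟨a, v₀, v₁, hA00, hA01, hA10, hA11⟩ := exists_unipotent_form hA
  have h' := congrArg (fun M : SL(2, F) => M 0 0) h
  have h10 : A 1 0 = 0 := by simpa [coe_upper, mul_apply, Fin.sum_univ_two] using h'
  rw [h10] at hA10
  have h2 : a * v₀ * v₁ = 0 := by
    rcases mul_eq_zero.1 (neg_eq_zero.1 hA10.symm) with h | h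
    · rw [h]; ring
    · rw [pow_eq_zero_iff two_ne_zero |>.1 h]; ring
  refine ⟨A 0 1, ?_⟩
  apply Subtype.ext
  refine (eta_fin_two A.1).trans ?_
  rw [coe_upper, h10, hA00, hA11, h2, sub_zero, add_zero]

/-- An element of order `p` which commutes with `lower t` is of the form `lower x`. -/
theorem eq_lower_of_commute {A : SL(2, F)} {t : F} (ht : t ≠ 0) (hA : A ^ p = 1)
    (h : A * lower t = lower t * A) : ∃ x, A = lower x := by
  obtain ⟨a, v₀, v₁, hA00, hA01, hA10, hA11⟩ := exists_unipotent_form hA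
  have h' := congrArg (fun M : SL(2, F) => M 0 0) h
  have h01 : A 0 1 = 0 := by simpa [ht, coe_lower, mul_apply, Fin.sum_univ_two] using h'
  rw [h01] at hA01
  have h2 : a * v₀ * v₁ = 0 := by
    rcases mul_eq_zero.1 (hA01.symm) with h | h
    · rw [h]; ring
    · rw [pow_eq_zero_iff two_ne_zero |>.1 h]; ring
  refine ⟨A 1 0, ?_⟩
  apply Subtype.ext
  refine (eta_fin_two A.1).trans ?_
  rw [coe_lower, h01, hA00, hA11, h2, sub_zero, add_zero]

end Unipotent

section Automorphisms

variable {F : Type} [Field F] [Finite F]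

/-- An automorphism `θ` of `SL(2, F)` that fixes `upper 1` and maps `lower 1` to some `lower t` is
induced by a field automorphism. By centralizers, `θ (upper x) = upper (φ x)` and
`θ (lower x) = lower (ψ x)` for additive maps `φ` and `ψ`; the conjugation relation between
`upper c` and `lower (-c⁻¹)` gives `ψ c⁻¹ = (φ c)⁻¹`, so that `θ` fixes `weyl` and maps `torus c` to
`torus (φ c)`, and `φ` is multiplicative. -/
theorem eq_slAut_of_upper_one (p : ℕ) [Fact p.Prime] [CharP F p] {θ : MulAut SL(2, F)}
    (hu : θ (upper 1) = upper 1) {t : F} (hl : θ (lower 1) = lower t) : ∃ σ : F ≃+* F, θ = slAut F σ := by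
  have ht : t ≠ 0 := by
    rintro rfl
    rw [lower_zero, EmbeddingLike.map_eq_one_iff, ← lower_zero] at hl
    exact one_ne_zero (lower_injective hl)
  have hcu : ∀ x y : F, upper x * upper y = upper y * upper x := fun x y => by
    rw [upper_mul, upper_mul, add_comm]
  have hcl : ∀ x y : F, lower x * lower y = lower y * lower x := fun x y => by
    rw [lower_mul, lower_mul, add_comm]
  have hφ : ∀ x, ∃ y, θ (upper x) = upper y := by
    intro x
    refine eq_upper_of_commute (p := p) ?_ ?_
    · rw [← map_pow, upper_pow, CharP.cast_eq_zero, zero_mul, upper_zero, map_one]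
    · rw [← hu, ← map_mul, ← map_mul, hcu]
  have hψ : ∀ x, ∃ y, θ (lower x) = lower y := by
    intro x
    refine eq_lower_of_commute (p := p) ht ?_ ?_
    · rw [← map_pow, lower_pow, CharP.cast_eq_zero, zero_mul, lower_zero, map_one]
    · rw [← hl, ← map_mul, ← map_mul, hcl]
  choose φ hφ using hφ
  choose ψ hψ using hψ
  have hφ_add : ∀ x y, φ (x + y) = φ x + φ y := fun x y => upper_injective <| by
    rw [← hφ, ← upper_mul, ← upper_mul, map_mul, hφ, hφ]
  have hψ_add : ∀ x y, ψ (x + y) = ψ x + ψ y := fun x y => lower_injective <| by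
    rw [← hψ, ← lower_mul, ← lower_mul, map_mul, hψ, hψ]
  have hφ_inj : Function.Injective φ := fun x y h =>
    upper_injective (θ.injective (by rw [hφ, hφ, h]))
  have hψ_inj : Function.Injective ψ := fun x y h =>
    lower_injective (θ.injective (by rw [hψ, hψ, h]))
  have hφ0 : φ 0 = 0 := by simpa using hφ_add 0 0
  have hψ0 : ψ 0 = 0 := by simpa using hψ_add 0 0
  have hψ_neg : ∀ x, ψ (-x) = -ψ x := fun x =>
    eq_neg_of_add_eq_zero_left (by rw [← hψ_add, neg_add_cancel, hψ0])
  have hφ1 : φ 1 = 1 := upper_injective (by rw [← hφ, hu])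
  have hinv : ∀ c, c ≠ 0 → φ c * ψ c⁻¹ = 1 := by
    intro c hc
    have h1 : ψ c⁻¹ ≠ 0 := fun h => inv_ne_zero hc (hψ_inj (h.trans hψ0.symm))
    rw [← upper_lower_relation h1]
    have h2 := congrArg θ ((upper_lower_relation (inv_ne_zero hc)).2 (mul_inv_cancel₀ hc))
    simpa only [map_mul, hφ, hψ, hψ_neg] using h2
  have hψ1 : ψ 1 = 1 := by simpa [hφ1] using hinv 1 one_ne_zero
  have hweyl : θ weyl = weyl := by
    rw [weyl_eq, map_mul, map_mul, hφ, hψ, hψ_neg, hφ1, hψ1]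
  have htorus : ∀ (c : Fˣ) (h : φ c ≠ 0), θ (torus c) = torus (Units.mk0 (φ c) h) := by
    intro c h
    refine mul_right_cancel (b := weyl) ?_
    rw [torus_eq, ← hweyl, ← map_mul, torus_eq, map_mul, map_mul, hφ, hψ, hψ_neg,
      eq_inv_of_mul_eq_one_right (hinv c c.ne_zero)]
    rfl
  have hφ_ne : ∀ c, c ≠ 0 → φ c ≠ 0 := fun c hc h => hc (hφ_inj (h.trans hφ0.symm))
  have hφ_mul : ∀ x y, φ (x * y) = φ x * φ y := by
    intro x y
    rcases eq_or_ne x 0 with rfl | hx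
    · rw [zero_mul, hφ0, zero_mul]
    rcases eq_or_ne y 0 with rfl | hy
    · rw [mul_zero, hφ0, mul_zero]
    have h := map_mul θ (torus (Units.mk0 x hx)) (torus (Units.mk0 y hy))
    rw [← map_mul, htorus _ (hφ_ne _ (mul_ne_zero hx hy)), htorus _ (hφ_ne _ hx),
      htorus _ (hφ_ne _ hy), ← map_mul] at h
    exact congrArg Units.val (torus_injective h)
  let φ' : F →+* F :=
    { toFun := φ, map_one' := hφ1, map_mul' := hφ_mul, map_zero' := hφ0, map_add' := hφ_add }
  let σ : F ≃+* F := RingEquiv.ofBijective φ' (Finite.injective_iff_bijective.1 hφ_inj)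
  refine ⟨σ, MulEquiv.toMonoidHom_injective (monoidHom_SL2_ext (fun x => ?_) fun x => ?_)⟩
  · change θ (upper x) = slAut F σ (upper x)
    rw [slAut_upper, hφ]
    rfl
  · change θ (lower x) = slAut F σ (lower x)
    rw [slAut_lower, hψ]
    congr 1
    rcases eq_or_ne x 0 with rfl | hx
    · rw [hψ0, map_zero]
    · have h := hinv x⁻¹ (inv_ne_zero hx)
      rw [inv_inv] at h
      have h' : φ x⁻¹ * σ x = 1 := by
        change φ x⁻¹ * φ x = 1
        rw [← hφ_mul, inv_mul_cancel₀ hx, hφ1]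
      exact mul_left_cancel₀ (hφ_ne _ (inv_ne_zero hx)) (h.trans h'.symm)

/-- Every automorphism of `SL(2, F)` is the product of a conjugation by a matrix and a field
automorphism. -/
theorem exists_eq_slConj_mul_slAut (p : ℕ) [Fact p.Prime] [CharP F p] (θ : MulAut SL(2, F)) :
    ∃ (g : GL (Fin 2) F) (σ : F ≃+* F), θ = slConj F g * slAut F σ := by
  have hne : (upper 1 : SL(2, F)) * lower 1 ≠ lower 1 * upper 1 := by
    intro h
    have := congrArg (fun M : SL(2, F) => M 0 0) h
    simp [coe_upper, coe_lower] at this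
  obtain ⟨g, s, t, hs, ht⟩ := exists_conj_upper_lower (p := p) (A := θ (upper 1))
    (B := θ (lower 1))
    (by rw [← map_pow, upper_pow, CharP.cast_eq_zero, zero_mul, upper_zero, map_one])
    (by rw [← map_pow, lower_pow, CharP.cast_eq_zero, zero_mul, lower_zero, map_one])
    (by rw [← map_mul, ← map_mul]; exact fun h => hne (θ.injective h))
  have hs0 : s ≠ 0 := by
    rintro rfl
    rw [upper_zero, map_one, eq_comm, EmbeddingLike.map_eq_one_iff, ← upper_zero] at hs
    exact one_ne_zero (upper_injective hs)
  have h1 : slConj F (diagGL (Units.mk0 s hs0)) (upper 1) = upper s :=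
    slConj_eq_of_mul_eq <| by
      ext i j
      fin_cases i <;> fin_cases j <;> simp [coe_diagGL, coe_upper]
  have h2 : slConj F (diagGL (Units.mk0 s hs0)) (lower (s * t)) = lower t :=
    slConj_eq_of_mul_eq <| by
      ext i j
      fin_cases i <;> fin_cases j <;> simp [coe_diagGL, coe_lower, mul_comm]
  obtain ⟨σ, hσ⟩ := eq_slAut_of_upper_one p
    (θ := (slConj F (g * diagGL (Units.mk0 s hs0)))⁻¹ * θ) (t := s * t)
    (by rw [MulAut.mul_apply, MulAut.inv_apply, MulEquiv.symm_apply_eq, map_mul, MulAut.mul_apply,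
      h1, hs])
    (by rw [MulAut.mul_apply, MulAut.inv_apply, MulEquiv.symm_apply_eq, map_mul, MulAut.mul_apply,
      h2, ht])
  exact ⟨_, σ, by rw [← hσ, mul_inv_cancel_left]⟩

end Automorphisms

/-! ### Automorphisms of `PSL(2, F)` -/

section ProjectiveAutomorphisms

variable {F : Type} [Field F]

/-- The projection `SL(2, F) → PSL(2, F)`. -/
def slToPSL (F : Type) [Field F] : SL(2, F) →* PSL(2, F) := QuotientGroup.mk' _

theorem slToPSL_surjective : Function.Surjective (slToPSL F) := QuotientGroup.mk'_surjective _

theorem isDoubleCover_slToPSL (h2 : (2 : F) ≠ 0) : IsDoubleCover (slToPSL F) (torus (-1)) where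
  ne_one := torus_neg_one_ne_one h2
  ker_iff M := (QuotientGroup.eq_one_iff M).trans (mem_center_SL2_iff M)

variable {β : F ≃+* F}

theorem pslIncl_slToPSL (M : SL(2, F)) : pslIncl F β (slToPSL F M) =
    SemidirectProduct.inl (SpecialLinearGroup.toPGL M) := rfl

theorem pslIncl_injective : Function.Injective (pslIncl F β) :=
  SemidirectProduct.inl_injective.comp ProjectiveSpecialLinearGroup.toPGL_injective

/-- Conjugation by `(g, γ)` on `PSL(2, F)` is induced by the action of `γ` on the entries followed by
conjugation by `g`. -/
theorem conj_pslIncl {x : PGLSemidirect F β} {g : GL (Fin 2) F}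
    (hg : ProjGenLinGroup.mk g = x.left) (M : SL(2, F)) :
    x * pslIncl F β (slToPSL F M) * x⁻¹ =
      pslIncl F β (slToPSL F (slConj F g (slAut F x.right.1 M))) := by
  rw [pslIncl_slToPSL, pslIncl_slToPSL, ← SemidirectProduct.inl_left_mul_inr_right x, ← hg,
    _root_.mul_inv_rev, ← map_inv SemidirectProduct.inr]
  simp only [SemidirectProduct.right_inl, SemidirectProduct.mul_right,
    SemidirectProduct.right_inr, one_mul]
  rw [show ∀ a b c d e : PGLSemidirect F β, a * b * c * (d * e) = a * (b * c * d) * e by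
      intros; simp only [mul_assoc],
    ← SemidirectProduct.inl_aut, ← map_inv, ← map_mul, ← map_mul]
  congr 1
  change ProjGenLinGroup.mk g * pglAut F x.right.1 (SpecialLinearGroup.toPGL M) *
    (ProjGenLinGroup.mk g)⁻¹ = ProjGenLinGroup.mk (SpecialLinearGroup.toGL _)
  rw [pglAut_toPGL, toGL_slConj, map_mul, map_mul, map_inv]
  rfl

theorem normal_range_pslIncl : (pslIncl F β).range.Normal where
  conj_mem := by
    rintro _ ⟨P, rfl⟩ x
    obtain ⟨M, rfl⟩ := slToPSL_surjective P
    obtain ⟨g, hg⟩ := ProjGenLinGroup.mk_surjective x.left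
    rw [conj_pslIncl hg]
    exact ⟨_, rfl⟩

/-- The conjugation action of `PGL(2, F) ⋊ ⟨β⟩` on its normal subgroup `PSL(2, F)`. -/
noncomputable def conjPSL (F : Type) [Field F] (β : F ≃+* F) : PGLSemidirect F β →* MulAut PSL(2, F) :=
  haveI := normal_range_pslIncl (β := β)
  (MulAut.congr (MonoidHom.ofInjective (pslIncl_injective (β := β))).symm).toMonoidHom.comp
    MulAut.conjNormal

theorem pslIncl_conjPSL (x : PGLSemidirect F β) (P : PSL(2, F)) :
    pslIncl F β (conjPSL F β x P) = x * pslIncl F β P * x⁻¹ := by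
  have := normal_range_pslIncl (β := β)
  exact congrArg Subtype.val ((MonoidHom.ofInjective (pslIncl_injective (β := β))).apply_symm_apply
    (MulAut.conjNormal x ⟨pslIncl F β P, P, rfl⟩))

theorem conjPSL_slToPSL {x : PGLSemidirect F β} {g : GL (Fin 2) F}
    (hg : ProjGenLinGroup.mk g = x.left) (M : SL(2, F)) :
    conjPSL F β x (slToPSL F M) = slToPSL F (slConj F g (slAut F x.right.1 M)) :=
  pslIncl_injective (by rw [pslIncl_conjPSL, conj_pslIncl hg])

theorem conjPSL_comp_pslIncl : (conjPSL F β).comp (pslIncl F β) = MulAut.conj := by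
  refine MonoidHom.ext fun P => MulEquiv.ext fun Q => pslIncl_injective (β := β) ?_
  rw [MonoidHom.comp_apply, pslIncl_conjPSL, MulAut.conj_apply, map_mul, map_mul, map_inv]

theorem range_coverMap_eq_range_pslIncl (hβ : β ^ 2 = 1) :
    (coverMap F β).range = (pslIncl F β).range := by
  ext x
  rw [mem_range_coverMap_iff, hβ, Subgroup.zpowers_one_eq_bot, Subgroup.mem_bot]
  constructor
  · rintro ⟨⟨M, hM⟩, h⟩
    exact ⟨slToPSL F M, SemidirectProduct.ext hM (Subtype.ext h.symm)⟩
  · rintro ⟨P, rfl⟩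
    obtain ⟨M, rfl⟩ := slToPSL_surjective P
    exact ⟨⟨M, rfl⟩, rfl⟩

variable [Finite F]

/-- If `(g, γ)` acts trivially on `PSL(2, F)`, it acts trivially on `SL(2, F)` by uniqueness of lifts;
the action on `upper 1` and `lower 1` shows that `g` is scalar, and then that on `upper y` shows
that `γ = 1`. -/
theorem conjPSL_injective (hF : 4 < Nat.card F) (h2 : (2 : F) ≠ 0) :
    Function.Injective (conjPSL F β) := by
  rw [injective_iff_map_eq_one]
  intro x hx
  obtain ⟨g, hg⟩ := ProjGenLinGroup.mk_surjective x.left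
  have h1 : ∀ M : SL(2, F), slConj F g (slAut F x.right.1 M) = M := fun M =>
    DFunLike.congr_fun ((isDoubleCover_slToPSL h2).lift_unique (odd_card_abelianization_SL2 hF)
      (l := (slConj F g * slAut F x.right.1).toMonoidHom) (l' := MonoidHom.id _) fun M => by
        change slToPSL F (slConj F g (slAut F x.right.1 M)) = slToPSL F M
        rw [← conjPSL_slToPSL hg, hx]
        rfl) M
  have h3 : ∀ M : SL(2, F), (g : Matrix (Fin 2) (Fin 2) F) * slAut F x.right.1 M = M * g := by
    intro M
    have h := congrArg SpecialLinearGroup.toGL (h1 M)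
    rw [toGL_slConj, mul_inv_eq_iff_eq_mul] at h
    exact congrArg Units.val h
  have hu := h3 (upper 1)
  have hl := h3 (lower 1)
  rw [slAut_upper, map_one] at hu
  rw [slAut_lower, map_one] at hl
  have hg10 : g 1 0 = 0 := by
    have := congrFun (congrFun hu 0) 0
    simpa [coe_upper, mul_apply, Fin.sum_univ_two] using this
  have hg01 : g 0 1 = 0 := by
    have := congrFun (congrFun hl 0) 0
    simpa [coe_lower, mul_apply, Fin.sum_univ_two] using this
  have hg11 : g 0 0 = g 1 1 := by
    have := congrFun (congrFun hu 0) 1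
    simpa [coe_upper, mul_apply, Fin.sum_univ_two, hg01] using this
  have hg0 : g 0 0 ≠ 0 := by
    intro h
    have h4 : (g : Matrix (Fin 2) (Fin 2) F).det = 0 := by
      rw [det_fin_two, h, hg10]; ring
    have h5 := (GeneralLinearGroup.det g).ne_zero
    rw [GeneralLinearGroup.val_det_apply] at h5
    exact h5 h4
  have hleft : x.left = 1 := by
    have : g = GeneralLinearGroup.scalar (Fin 2) (Units.mk0 _ hg0) := by
      apply Units.ext
      rw [GeneralLinearGroup.coe_scalar]
      ext i j
      fin_cases i <;> fin_cases j <;> simp [hg01, hg10, hg11]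
    rw [← hg, this, ProjGenLinGroup.mk_scalar]
  have hright : x.right = 1 := by
    apply Subtype.ext
    ext y
    have h := congrFun (congrFun (h3 (upper y)) 0) 1
    rw [slAut_upper] at h
    have h' : g 0 0 * x.right.1 y = g 0 0 * y := by
      simpa [coe_upper, mul_apply, Fin.sum_univ_two, hg01, hg11, mul_comm] using h
    exact mul_left_cancel₀ hg0 h'
  exact SemidirectProduct.ext hleft hright

/-- If `β` generates the automorphism group of `F`, then each automorphism of `PSL(2, F)` comes
from `PGL(2, F) ⋊ ⟨β⟩`: it lifts to `SL(2, F)`, as this is the universal double cover. -/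
theorem conjPSL_surjective (p : ℕ) [Fact p.Prime] [CharP F p] (hF1 : Nat.card F % 4 = 1)
    (hF : 4 < Nat.card F) (hβ : ∀ σ, σ ∈ Subgroup.zpowers β) :
    Function.Surjective (conjPSL F β) := by
  intro φ
  have hd := isDoubleCover_slToPSL (two_ne_zero_of_odd_card hF1)
  have hlift : ∀ φ : MulAut PSL(2, F), ∃ l : SL(2, F) →* SL(2, F),
      ∀ M, slToPSL F (l M) = φ (slToPSL F M) := fun φ =>
    hd.exists_lift (splitsModTwo_SL2 hF1 hF) (φ.toMonoidHom.comp (slToPSL F)) fun _ =>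
      slToPSL_surjective _
  obtain ⟨l, hl⟩ := hlift φ
  obtain ⟨l', hl'⟩ := hlift φ⁻¹
  have h1 : l.comp l' = MonoidHom.id _ :=
    hd.lift_unique (odd_card_abelianization_SL2 hF) fun M => by
      rw [MonoidHom.comp_apply, hl, hl', MulAut.apply_inv_self]; rfl
  have h2 : l'.comp l = MonoidHom.id _ :=
    hd.lift_unique (odd_card_abelianization_SL2 hF) fun M => by
      rw [MonoidHom.comp_apply, hl', hl, MulAut.inv_apply_self]; rfl
  obtain ⟨g, σ, hθ⟩ := exists_eq_slConj_mul_slAut p (l.toMulEquiv l' h2 h1 : MulAut SL(2, F))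
  refine ⟨⟨ProjGenLinGroup.mk g, ⟨σ, hβ σ⟩⟩, MulEquiv.ext fun P => ?_⟩
  obtain ⟨M, rfl⟩ := slToPSL_surjective P
  rw [conjPSL_slToPSL rfl, ← hl]
  exact congrArg (slToPSL F) (DFunLike.congr_fun hθ M).symm

/-- The Frobenius automorphism generates the automorphism group of a finite field. -/
theorem mem_zpowers_frobenius (p : ℕ) [Fact p.Prime] [CharP F p] (σ : F ≃+* F) :
    σ ∈ Subgroup.zpowers (frobeniusEquiv F p) := by
  let := ZMod.algebra F p
  obtain ⟨n, hn⟩ := (FiniteField.bijective_frobeniusAlgEquivOfAlgebraic_pow (ZMod p) F).2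
    (AlgEquiv.ofRingEquiv (f := σ) fun x =>
      DFunLike.congr_fun (Subsingleton.elim ((σ : F →+* F).comp (algebraMap (ZMod p) F))
        (algebraMap (ZMod p) F)) x)
  refine ⟨n.1, RingEquiv.ext fun x => ?_⟩
  have h := DFunLike.congr_fun hn x
  dsimp only at h ⊢
  rw [zpow_natCast, ← iterateFrobeniusEquiv_eq_pow, iterateFrobeniusEquiv_def]
  rw [AlgEquiv.coe_pow, FiniteField.coe_frobeniusAlgEquivOfAlgebraic, pow_iterate, ZMod.card] at h
  exact h

theorem commutator_PSL2_eq_top (hF : 4 < Nat.card F) : commutator PSL(2, F) = ⊤ := by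
  rw [← Subgroup.map_top_of_surjective _ (slToPSL_surjective (F := F)),
    ← commutator_SL2_eq_top hF]
  simp only [commutator_def, Subgroup.map_commutator,
    Subgroup.map_top_of_surjective _ slToPSL_surjective]

end ProjectiveAutomorphisms

end EmbeddingObstruction

theorem mainTheorem9 (p m : ℕ) [Fact p.Prime] (hp : p ≠ 2) (hm : 0 < m)
    (F : Type) [Field F] [Finite F] [CharP F p] (hF : Nat.card F = (p ^ m) ^ 2) :
    -- the kernel is perfect and has `H₂ = ℤ/2`
    (commutator PSL(2, F) = ⊤ ∧ Nonempty (Homology2 PSL(2, F) (ZMod 2) ≃+ ZMod 2)) ∧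
    -- `PGL(2, q²) ⋊ ⟨α⟩` with `α : x ↦ x ^ q`, `q = p ^ m`
    (∃ f : PGLSemidirect F (iterateFrobeniusEquiv F p m) →* V4,
      Function.Injective (pslIncl F (iterateFrobeniusEquiv F p m)) ∧
      (pslIncl F (iterateFrobeniusEquiv F p m)).range = f.ker ∧ ExhibitsStarB f) ∧
    -- `Aut(PSL(2, q²))` is the above group for `m = 1`
    (m = 1 → ∃ f : MulAut PSL(2, F) →* V4,
      Function.Injective (MulAut.conj : PSL(2, F) →* MulAut PSL(2, F)) ∧
      (MulAut.conj : PSL(2, F) →* MulAut PSL(2, F)).range = f.ker ∧ ExhibitsStarB f) ∧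
    (Odd m → HasStarB (MulAut PSL(2, F))) := by
  obtain ⟨r, hr⟩ : ∃ r, p ^ m = 2 * r + 1 := ((Fact.out : p.Prime).odd_of_ne_two hp).pow
  have hr0 : 0 < r := by
    have h1 := Nat.one_lt_pow hm.ne' (Fact.out : p.Prime).one_lt
    omega
  have hF' : Nat.card F = (2 * r + 1) ^ 2 := by rw [hF, hr]
  have hF4 : 4 < Nat.card F := by rw [hF']; nlinarith
  have hF1 : Nat.card F % 4 = 1 := by
    rw [show Nat.card F = 4 * (r * (r + 1)) + 1 by rw [hF']; ring]; omega
  have h2 := two_ne_zero_of_odd_card hF1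
  have hα : ∀ x, iterateFrobeniusEquiv F p m x = x ^ (2 * r + 1) := fun x => by
    rw [iterateFrobeniusEquiv_def, hr]
  have hα2 : iterateFrobeniusEquiv F p m ^ 2 = 1 := by
    rw [pow_two]
    ext x
    change iterateFrobeniusEquiv F p m (iterateFrobeniusEquiv F p m x) = x
    have := Fintype.ofFinite F
    rw [hα, hα, ← pow_mul, ← pow_two, ← hF', Nat.card_eq_fintype_card, FiniteField.pow_card]
  let ψ : MulAut PSL(2, F) ≃* PGLSemidirect F (frobeniusEquiv F p) :=
    (MulEquiv.ofBijective (conjPSL F (frobeniusEquiv F p))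
      ⟨conjPSL_injective hF4 h2,
        conjPSL_surjective p hF1 hF4 (mem_zpowers_frobenius p)⟩).symm
  have hψ : ∀ P, ψ (MulAut.conj P) = pslIncl F (frobeniusEquiv F p) P := fun P =>
    (MulEquiv.symm_apply_eq _).2 (DFunLike.congr_fun conjPSL_comp_pslIncl P).symm
  have hβ : ∀ x, (frobeniusEquiv F p ^ m) x = x ^ (2 * r + 1) := fun x => by
    rw [← iterateFrobeniusEquiv_eq_pow, hα]
  refine ⟨⟨commutator_PSL2_eq_top hF4, ?_⟩, ?_, ?_, ?_⟩
  · exact nonempty_homology2_addEquiv slToPSL_surjective (isDoubleCover_slToPSL h2)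
      (splitsModTwo_SL2 hF1 hF4) (odd_card_abelianization_SL2 hF4)
  · obtain ⟨f, hf, hker⟩ := exists_exhibitsStarB (β := iterateFrobeniusEquiv F p m) hr0 hF'
      odd_one (by simpa only [pow_one] using hα) (MulEquiv.refl _)
    refine ⟨f, pslIncl_injective, ?_, hf⟩
    ext x
    rw [hker, range_coverMap_eq_range_pslIncl hα2]
    rfl
  · rintro rfl
    obtain ⟨f, hf, hker⟩ := exists_exhibitsStarB hr0 hF' odd_one hβ ψ
    refine ⟨f, fun P Q h => pslIncl_injective ((hψ P).symm.trans (h ▸ hψ Q)), ?_, hf⟩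
    ext x
    rw [hker, range_coverMap_eq_range_pslIncl (by rw [← iterateFrobeniusEquiv_one, hα2])]
    refine exists_congr fun P => ?_
    rw [← hψ, EmbeddingLike.apply_eq_iff_eq]
  · intro h
    obtain ⟨f, hf, -⟩ := exists_exhibitsStarB hr0 hF' h hβ ψ
    exact ⟨f, hf⟩
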